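/- Let $n\ge 1$ and let $(M^n,g)$ be an $n$-dimensional $C^\infty$ Riemannian manifold of constant sectional curvature $-1$. Let $v_1^0,\dots,v_n^0$ be orthonormal vectors in the tangent space $T_{p^0}M$ at a point $p^0\in M$. Then there exist smooth local coordinates $y_1,\dots,y_n$ on an open neighbourhood of $p^0$ such that: (a) the coordinates are orthogonal, i.e. $g(\partial/\partial y_i,\partial/\partial y_j)=0$ for $i\ne j$ on the whole coordinate domain; (b) every $y_1$-coordinate curve $\gamma$ (integral curve of $\partial/\partial y_1$) is a geodesic, $\frac{D}{dt}\gamma'=0$; (c) for every $i\ge 2$, every $y_i$-coordinate curve is a horocycle, i.e. it is regular and, with respect to an arc length parameter $\sigma$, its unit tangent field $T$ and some unit normal field $N$ along it satisfy $\frac{D}{d\sigma}T=N$ and $\frac{D}{d\sigma}N=-T$ (geodesic curvature $1$ and no torsion); (d) at $p^0$ the coordinate curves are tangent to the given vectors: for each $i$, $v_i^0$ is a positive multiple of $\partial/\partial y_i|_{p^0}$. -/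

import Mathlib

open scoped Manifold ContDiff

noncomputable section

namespace RiemannianCoordinates

/-- A smooth Riemannian metric on an `n`-dimensional smooth manifold `M`. -/
abbrev SmoothMetric (n : ℕ) (M : Type*) [TopologicalSpace M]
    [ChartedSpace (EuclideanSpace ℝ (Fin n)) M] [IsManifold (𝓡 n) ∞ M] : Type _ :=
  Bundle.ContMDiffRiemannianMetric (𝓡 n) ∞ (EuclideanSpace ℝ (Fin n))
    (fun p : M ↦ TangentSpace (𝓡 n) p)

/-- The `i`-th standard basis vector of `ℝⁿ`. -/
def basisVec {n : ℕ} (i : Fin n) : EuclideanSpace ℝ (Fin n) := EuclideanSpace.single i (1 : ℝ)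

/-- The `i`-th partial derivative of a real function on `ℝⁿ`. -/
def partialDeriv {n : ℕ} (i : Fin n) (f : EuclideanSpace ℝ (Fin n) → ℝ)
    (x : EuclideanSpace ℝ (Fin n)) : ℝ :=
  fderiv ℝ f x (basisVec i)

section Local

variable {n : ℕ} {M : Type*} [TopologicalSpace M] [ChartedSpace (EuclideanSpace ℝ (Fin n)) M]

/-- The coordinate vector `∂/∂φᵢ` of the chart `φ` at the point with coordinates `x`. -/
def coordVec (φ : OpenPartialHomeomorph M (EuclideanSpace ℝ (Fin n)))
    (x : EuclideanSpace ℝ (Fin n)) (i : Fin n) : TangentSpace (𝓡 n) (φ.symm x) :=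
  mfderiv (𝓡 n) (𝓡 n) φ.symm x (basisVec i)

/-- The components `dφ(u)` of the tangent vector `u` with respect to the coordinate vectors of
the chart `φ`. -/
def components (φ : OpenPartialHomeomorph M (EuclideanSpace ℝ (Fin n))) (p : M)
    (u : TangentSpace (𝓡 n) p) : EuclideanSpace ℝ (Fin n) :=
  mfderiv (𝓡 n) (𝓡 n) φ p u

/-- The velocity vector `γ'(t)` of a curve. -/
def velocity (γ : ℝ → M) (t : ℝ) : TangentSpace (𝓡 n) (γ t) :=
  mfderiv 𝓘(ℝ, ℝ) (𝓡 n) γ t (1 : ℝ)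

variable [IsManifold (𝓡 n) ∞ M]

/-- The matrix `gᵢⱼ = g(∂/∂φᵢ, ∂/∂φⱼ)` of the metric in the chart `φ`. -/
def metricMatrix (g : SmoothMetric n M)
    (φ : OpenPartialHomeomorph M (EuclideanSpace ℝ (Fin n)))
    (x : EuclideanSpace ℝ (Fin n)) : Matrix (Fin n) (Fin n) ℝ :=
  Matrix.of fun i j ↦ g.inner (φ.symm x) (coordVec φ x i) (coordVec φ x j)

/-- The Christoffel symbols `Γᵏᵢⱼ` of the Levi-Civita connection of `g` in the chart `φ`. -/
def christoffel (g : SmoothMetric n M)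
    (φ : OpenPartialHomeomorph M (EuclideanSpace ℝ (Fin n)))
    (k i j : Fin n) (x : EuclideanSpace ℝ (Fin n)) : ℝ :=
  (1 / 2) * ∑ l, (metricMatrix g φ x)⁻¹ k l *
    (partialDeriv i (fun z ↦ metricMatrix g φ z j l) x
      + partialDeriv j (fun z ↦ metricMatrix g φ z i l) x
      - partialDeriv l (fun z ↦ metricMatrix g φ z i j) x)

/-- The `l`-th component of `R(∂ᵢ, ∂ⱼ)∂ₖ` in the chart `φ`, where `R` is the Riemann curvature
tensor `R(X, Y)Z = ∇_X ∇_Y Z - ∇_Y ∇_X Z - ∇_[X,Y] Z` of the Levi-Civita connection. -/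
def curvatureTensor (g : SmoothMetric n M)
    (φ : OpenPartialHomeomorph M (EuclideanSpace ℝ (Fin n)))
    (l k i j : Fin n) (x : EuclideanSpace ℝ (Fin n)) : ℝ :=
  partialDeriv i (christoffel g φ l j k) x - partialDeriv j (christoffel g φ l i k) x
    + ∑ m, (christoffel g φ l i m x * christoffel g φ m j k x
      - christoffel g φ l j m x * christoffel g φ m i k x)

/-- The sectional curvature `g(R(u, w)w, u) / (g(u, u) g(w, w) - g(u, w)²)` of the plane spanned
by `u, w ∈ T_pM`, computed in the chart `φ`. -/
def sectionalCurvature (g : SmoothMetric n M)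
    (φ : OpenPartialHomeomorph M (EuclideanSpace ℝ (Fin n)))
    (p : M) (u w : TangentSpace (𝓡 n) p) : ℝ :=
  (∑ i, ∑ j, ∑ k, ∑ l, ∑ m, metricMatrix g φ (φ p) l m * curvatureTensor g φ l k i j (φ p)
      * components φ p u i * components φ p w j * components φ p w k * components φ p u m)
    / (g.inner p u u * g.inner p w w - g.inner p u w ^ 2)

/-- All sectional curvatures of `(M, g)` are equal to `K`. (The sectional curvature does not depend
on the smooth chart in which it is computed.) -/
def HasConstantSectionalCurvature (g : SmoothMetric n M) (K : ℝ) : Prop :=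
  ∀ φ ∈ IsManifold.maximalAtlas (𝓡 n) ∞ M, ∀ p ∈ φ.source, ∀ u w : TangentSpace (𝓡 n) p,
    LinearIndependent ℝ ![u, w] → sectionalCurvature g φ p u w = K

/-- `W = D_t V` at time `t`: the curve `γ` and the vector field `V` along `γ` are differentiable at
`t`, and `W ∈ T_{γ(t)}M` is the covariant derivative of `V` along `γ` at `t`, that is,
`Wᵏ = dVᵏ/dt + ∑ Γᵏᵢⱼ (γ')ⁱ Vʲ` in smooth local coordinates around `γ(t)`. (The condition is the
same for all smooth charts around `γ(t)`.) -/
def HasCovDerivAlongAt (g : SmoothMetric n M) (γ : ℝ → M)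
    (V : ∀ t, TangentSpace (𝓡 n) (γ t)) (t : ℝ) (W : TangentSpace (𝓡 n) (γ t)) : Prop :=
  MDifferentiableAt 𝓘(ℝ, ℝ) (𝓡 n) γ t ∧
  ∃ φ ∈ IsManifold.maximalAtlas (𝓡 n) ∞ M, γ t ∈ φ.source ∧
    ∃ V' : EuclideanSpace ℝ (Fin n),
      HasDerivAt (fun s ↦ components φ (γ s) (V s)) V' t ∧
      ∀ k, components φ (γ t) W k = V' k + ∑ i, ∑ j, christoffel g φ k i j (φ (γ t))
        * components φ (γ t) (velocity γ t) i * components φ (γ t) (V t) j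

/-- The smooth curve `γ` is a geodesic on the open set `s` of parameters: `D_t γ' = 0`. -/
def IsGeodesicOn (g : SmoothMetric n M) (γ : ℝ → M) (s : Set ℝ) : Prop :=
  ContMDiffOn 𝓘(ℝ, ℝ) (𝓡 n) ∞ γ s ∧ ∀ t ∈ s, HasCovDerivAlongAt g γ (velocity γ) t 0

/-- The speed `|γ'(t)|`. -/
def speed (g : SmoothMetric n M) (γ : ℝ → M) (t : ℝ) : ℝ :=
  √(g.inner (γ t) (velocity γ t) (velocity γ t))

/-- The unit tangent vector `γ'(t) / |γ'(t)|`. -/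
def unitTangent (g : SmoothMetric n M) (γ : ℝ → M) (t : ℝ) : TangentSpace (𝓡 n) (γ t) :=
  (speed g γ t)⁻¹ • velocity γ t

/-- The smooth curve `γ` is a horocycle on the open set `s` of parameters, in a Riemannian manifold
of constant sectional curvature `-1`: it is regular, and with an arc length parameter `σ`, the
unit tangent `T` and a unit normal field `N` it satisfies the Frenet equations
`D_σ T = N`, `D_σ N = -T` of a curve of geodesic curvature `1` without torsion, i.e. of a curve of
geodesic curvature `1` in a totally geodesic surface. The parametrization of `γ` is
arbitrary, whence the factors `|γ'|`. -/
def IsHorocycleOn (g : SmoothMetric n M) (γ : ℝ → M) (s : Set ℝ) : Prop :=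
  ContMDiffOn 𝓘(ℝ, ℝ) (𝓡 n) ∞ γ s ∧ (∀ t ∈ s, velocity (n := n) γ t ≠ 0) ∧
  ∃ N : ∀ t, TangentSpace (𝓡 n) (γ t), ∀ t ∈ s,
    g.inner (γ t) (N t) (N t) = 1 ∧
    g.inner (γ t) (N t) (unitTangent g γ t) = 0 ∧
    HasCovDerivAlongAt g γ (unitTangent g γ) t (speed g γ t • N t) ∧
    HasCovDerivAlongAt g γ N t (-(speed g γ t • unitTangent g γ t))

end Local

/-- The `i`-th coordinate curve of the chart `y` through the point with coordinates `x`. -/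
def coordCurve {n : ℕ} {M : Type*} [TopologicalSpace M]
    (y : OpenPartialHomeomorph M (EuclideanSpace ℝ (Fin n)))
    (x : EuclideanSpace ℝ (Fin n)) (i : Fin n) (t : ℝ) : M :=
  y.symm (x + t • basisVec i)

/-- The open set of parameters for which `coordCurve y x i` stays in the coordinate domain. -/
def coordCurveDomain {n : ℕ} {M : Type*} [TopologicalSpace M]
    (y : OpenPartialHomeomorph M (EuclideanSpace ℝ (Fin n)))
    (x : EuclideanSpace ℝ (Fin n)) (i : Fin n) : Set ℝ :=
  {t | x + t • basisVec i ∈ y.target}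

end RiemannianCoordinates

end

/-! ### Flat linear total differential equations -/

noncomputable section

namespace FlatSystem

open unitInterval

/-! The idea is to find coordinates in which the metric is the horospherical form `dz₀² + e^{-2 z₀}
∑_{i ≠ 0} dz_i²` of the hyperbolic metric. In such coordinates orthogonality is immediate, and the
Christoffel symbols give the rest: `∇_{∂₀} ∂₀ = 0`, and for `i ≠ 0`, `∇_{∂ᵢ} ∂ᵢ = e^{-2 z₀} ∂₀` and
`∇_{∂ᵢ} ∂₀ = -∂ᵢ`. Since `z₀` is constant on a `z_i`-curve, its speed is `e^{-z₀}`, and `T = e^{z₀}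
∂ᵢ`, `N = ∂₀` satisfy the Frenet equations of a horocycle.

The coordinates come from a local isometry to the hyperboloid in Minkowski space. On a manifold of
curvature `-1`, the equation `Hess f = f g` prolongs to a linear connection on pairs `(f, Z)`,
namely `df = g(·, Z)`, `∇_h Z = f h`. This connection is flat precisely because `R(u,v)w = g(u,w) v
- g(v,w) u` (`IsLeviCivitaOn.hessianSystem_flat`), so Frobenius' theorem
(`FlatSystem.exists_solution`) gives a parallel section for each initial value. The Lorentzian form
`g(Z,Z') - f f'` is preserved (`form_eq_of_isParallelAt`). The first components `a`, `b_i` of the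
sections starting at `(1,0)` and `(0, v_i⁰)` therefore satisfy `∑ b_i² - a² = -1` and `g = ∑ db_i² -
da²` (`exists_hyperboloid_immersion`).

Then `z₀ = -log (a - b₀)` and `z_i = b_i / (a - b₀)` give the horospherical form
(`sum_horospherical`). At the base point `a = 1`, `b = 0`, `da = 0`, so `dz_i = db_i`, and the
prescribed frame becomes the coordinate frame. The inverse function theorem turns the map into a
chart.

Two ingredients connect this with the definitions: sectional curvature determines the curvature
tensor (`eq_zero_of_sectional`, `curvature_eq`), and the Christoffel formulas in a chart define the
Levi-Civita connection (`isLeviCivitaOn_chart`). -/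

theorem eventually_norm_sub_lt {E F : Type*} [TopologicalSpace E] [SeminormedAddCommGroup F]
    {f : E → F} {x : E} (hf : ContinuousAt f x) {c : ℝ} (hc : 0 < c) :
    ∀ᶠ y in nhds x, ‖f y - f x‖ < c :=
  (tendsto_iff_norm_sub_tendsto_zero.1 hf.tendsto).eventually (gt_mem_nhds hc)

theorem eventually_norm_lt {E F : Type*} [TopologicalSpace E] [SeminormedAddCommGroup F]
    {f : E → F} {x : E} (hf : ContinuousAt f x) (h0 : f x = 0) {c : ℝ} (hc : 0 < c) :
    ∀ᶠ y in nhds x, ‖f y‖ < c := by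
  simpa [h0] using eventually_norm_sub_lt hf hc

/-! ### Differentiability of maps into spaces of continuous functions -/

section ContinuousMap

variable {X E F : Type*} [TopologicalSpace X] [CompactSpace X]
  [NormedAddCommGroup E] [NormedSpace ℝ E] [NormedAddCommGroup F] [NormedSpace ℝ F]

/-- A continuous family of linear maps, as a linear map into the continuous functions. -/
def familyApply (g : C(X, E →L[ℝ] F)) : E →L[ℝ] C(X, F) :=
  LinearMap.mkContinuous
    { toFun := fun h ↦ ⟨fun s ↦ g s h, by fun_prop⟩
      map_add' := fun a b ↦ by ext s; simp
      map_smul' := fun c a ↦ by ext s; simp } ‖g‖ fun h ↦ by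
    rw [ContinuousMap.norm_le _ (by positivity)]
    exact fun s ↦ (g s).le_of_opNorm_le (g.norm_coe_le_norm s) h

@[simp] theorem familyApply_apply (g : C(X, E →L[ℝ] F)) (h : E) (s : X) :
    familyApply g h s = g s h := rfl

/-- A family of functions which is pointwise differentiable, with a derivative that is continuous
uniformly in the parameter, is differentiable as a map into the continuous functions. -/
theorem hasFDerivAt_continuousMap {f : E → C(X, F)} {f' : E → C(X, E →L[ℝ] F)}
    (hf' : Continuous f') (h : ∀ x s, HasFDerivAt (fun y ↦ f y s) (f' x s) x) (x : E) :
    HasFDerivAt f (familyApply (f' x)) x := by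
  rw [hasFDerivAt_iff_isLittleO, Asymptotics.isLittleO_iff]
  intro c hc
  have hev : ∀ᶠ y in nhds x, ‖f' y - f' x‖ < c :=
    eventually_norm_sub_lt (F := C(X, E →L[ℝ] F)) hf'.continuousAt hc
  obtain ⟨δ, hδ, H⟩ := Metric.eventually_nhds_iff.1 hev
  filter_upwards [Metric.ball_mem_nhds x hδ] with y hy
  rw [ContinuousMap.norm_le _ (by positivity)]
  intro s
  -- The mean value inequality is applied for each `s` separately; `δ` does not depend on `s`,
  -- because `f'` is continuous for the supremum norm.
  refine (convex_ball x δ).norm_image_sub_le_of_norm_hasFDerivWithin_le'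
    (f := fun y ↦ f y s) (f' := fun y ↦ f' y s) (φ := f' x s)
    (fun z _ ↦ (h z s).hasFDerivWithinAt) (fun z hz ↦ ?_) (Metric.mem_ball_self hδ) hy
  exact ((f' z - f' x).norm_coe_le_norm s).trans (H hz).le

end ContinuousMap

/-! ### Integration as a bounded operator on continuous functions -/

section Primitive

variable {F : Type*} [NormedAddCommGroup F]

theorem continuous_comp_projIcc (u : C(I, F)) :
    Continuous fun r : ℝ ↦ u (Set.projIcc 0 1 zero_le_one r) :=
  u.continuous.comp continuous_projIcc

variable [NormedSpace ℝ F]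

/-- The primitive of a continuous function on the unit interval, extended to the line. -/
def primitive (u : C(I, F)) (s : ℝ) : F := ∫ r in (0 : ℝ)..s, u (Set.projIcc 0 1 zero_le_one r)

theorem hasDerivAt_primitive [CompleteSpace F] (u : C(I, F)) (s : ℝ) :
    HasDerivAt (primitive u) (u (Set.projIcc 0 1 zero_le_one s)) s :=
  intervalIntegral.integral_hasDerivAt_right
    ((continuous_comp_projIcc u).intervalIntegrable _ _)
    ((continuous_comp_projIcc u).stronglyMeasurableAtFilter _ _)
    (continuous_comp_projIcc u).continuousAt

@[simp] theorem primitive_zero (u : C(I, F)) : primitive u 0 = 0 := by simp [primitive]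

/-- The integration operator on the continuous functions on the unit interval. -/
def integration [CompleteSpace F] : C(I, F) →L[ℝ] C(I, F) :=
  LinearMap.mkContinuous
    { toFun := fun u ↦ ⟨fun s ↦ primitive u s, by
        have : Continuous (primitive u) :=
          continuous_iff_continuousAt.2 fun s ↦ (hasDerivAt_primitive u s).continuousAt
        fun_prop⟩
      map_add' := fun a b ↦ by
        ext s
        exact intervalIntegral.integral_add ((continuous_comp_projIcc a).intervalIntegrable _ _)
          ((continuous_comp_projIcc b).intervalIntegrable _ _)
      map_smul' := fun c a ↦ by
        ext s
        exact intervalIntegral.integral_smul c _ } 1 fun u ↦ by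
    rw [ContinuousMap.norm_le _ (by positivity)]
    intro s
    have := intervalIntegral.norm_integral_le_of_norm_le_const (a := 0) (b := (s : ℝ)) (C := ‖u‖)
      (f := fun r ↦ u (Set.projIcc 0 1 zero_le_one r)) (fun r _ ↦ u.norm_coe_le_norm _)
    refine this.trans ?_
    rw [sub_zero, abs_of_nonneg s.2.1]
    nlinarith [norm_nonneg u, s.2.2]

end Primitive

theorem hasFDerivAt_comp_mul {E C : Type*} [NormedAddCommGroup E] [NormedSpace ℝ E]
    [NormedRing C] [NormedAlgebra ℝ C] (J : C →L[ℝ] C) {b : E → C} {b' : E →L[ℝ] C} {x : E}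
    (hb : HasFDerivAt b b' x) :
    HasFDerivAt (fun y ↦ J ∘L ContinuousLinearMap.mul ℝ C (b y))
      (ContinuousLinearMap.compL ℝ C C C J ∘L ContinuousLinearMap.mul ℝ C ∘L b') x :=
  ((ContinuousLinearMap.compL ℝ C C C J) ∘L ContinuousLinearMap.mul ℝ C).hasFDerivAt.comp x hb

/-! ### Linear equations of the second kind depending on a parameter -/

section Resolvent

variable {E F : Type*} [NormedAddCommGroup E] [NormedSpace ℝ E] [NormedAddCommGroup F]
  [NormedSpace ℝ F] [CompleteSpace F]

theorem isUnit_one_sub {T : F →L[ℝ] F} (hT : ‖T‖ < 1) : IsUnit (1 - T) :=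
  ⟨Units.oneSub T hT, rfl⟩

theorem inverse_one_sub_apply {T : F →L[ℝ] F} (hT : ‖T‖ < 1) (c : F) :
    Ring.inverse (1 - T) c = c + T (Ring.inverse (1 - T) c) := by
  have h := Ring.mul_inverse_cancel _ (isUnit_one_sub hT)
  have h2 := congrArg (fun S : F →L[ℝ] F ↦ S c) h
  simp only [mul_apply_eq_comp, sub_apply, one_apply_eq_self] at h2
  exact eq_add_of_sub_eq h2

/-- The derivative of the solution of a linear equation of the second kind with respect to a
parameter. -/
theorem exists_hasFDerivAt_inverse_one_sub {K : E → F →L[ℝ] F} {K' : E →L[ℝ] F →L[ℝ] F} {x : E}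
    (hK : HasFDerivAt K K' x) (hx : ‖K x‖ < 1) (c : F) :
    ∃ D : E →L[ℝ] F, HasFDerivAt (fun y ↦ Ring.inverse (1 - K y) c) D x ∧
      ∀ h, D h = K x (D h) + K' h (Ring.inverse (1 - K x) c) := by
  obtain ⟨v, hv⟩ := isUnit_one_sub hx
  have h1 : HasFDerivAt (fun y ↦ 1 - K y) (-K') x := hK.const_sub 1
  have h2 := hasFDerivAt_ringInverse (𝕜 := ℝ) v
  rw [hv] at h2
  have h3 := (h2.comp x h1).clm_apply (hasFDerivAt_const c x)
  -- With `y = (1 - K)⁻¹ c`, differentiating `(1 - K) y = c` gives `(1 - K) Dy = K' y`, hence this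
  -- `D`.
  obtain ⟨D, hD⟩ : ∃ D : E →L[ℝ] F,
    D = (↑v⁻¹ : F →L[ℝ] F) ∘L K'.flip (Ring.inverse (1 - K x) c) := ⟨_, rfl⟩
  refine ⟨D, h3.congr_fderiv ?_, fun h ↦ ?_⟩
  · ext h
    rw [hD, ← hv, Ring.inverse_unit]
    simp
  have h6 : D h = (↑v⁻¹ : F →L[ℝ] F) (K' h (Ring.inverse (1 - K x) c)) := by rw [hD]; rfl
  have h7 := congrArg (fun T : F →L[ℝ] F ↦ T (K' h (Ring.inverse (1 - K x) c))) v.mul_inv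
  simp only [mul_apply_eq_comp, one_apply_eq_self, ← h6] at h7
  rw [hv, sub_apply, one_apply_eq_self] at h7
  exact eq_add_of_sub_eq' h7

end Resolvent

/-! ### Existence for flat systems with global coefficients, by integration along rays -/

section Existence

variable {E R : Type*} [NormedAddCommGroup E] [NormedSpace ℝ E]
  [NormedRing R] [NormedAlgebra ℝ R]

/-- The coefficient of the equation along the ray `s ↦ s • x`. -/
def rayCoeff (A : E → E →L[ℝ] R) (hA : Continuous A) (x : E) : C(I, R) :=
  ⟨fun s ↦ A ((s : ℝ) • x) x, by fun_prop⟩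

/-- The derivative of `rayCoeff` in the direction of the endpoint. -/
def rayCoeffDeriv (A : E → E →L[ℝ] R) (hA : ContDiff ℝ 1 A) (x : E) : C(I, E →L[ℝ] R) :=
  ⟨fun s ↦ (s : ℝ) • (fderiv ℝ A ((s : ℝ) • x)).flip x + A ((s : ℝ) • x), by
    have h1 : Continuous (fderiv ℝ A) := hA.continuous_fderiv one_ne_zero
    have h2 := hA.continuous
    have h3 : Continuous fun s : I ↦ (fderiv ℝ A ((s : ℝ) • x)).flip x := by
      have := (ContinuousLinearMap.flipₗᵢ ℝ E E R).continuous
      exact ((this.comp h1).comp (by fun_prop : Continuous fun s : I ↦ (s : ℝ) • x)).clm_apply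
        continuous_const
    fun_prop⟩

theorem continuous_rayCoeffDeriv (A : E → E →L[ℝ] R) (hA : ContDiff ℝ 1 A) :
    Continuous (rayCoeffDeriv A hA) := by
  refine ContinuousMap.continuous_of_continuous_uncurry _ ?_
  have h1 : Continuous (fderiv ℝ A) := hA.continuous_fderiv one_ne_zero
  have h2 := hA.continuous
  have h3 : Continuous fun p : E × I ↦ (fderiv ℝ A ((p.2 : ℝ) • p.1)).flip p.1 := by
    have := (ContinuousLinearMap.flipₗᵢ ℝ E E R).continuous
    exact ((this.comp h1).comp (by fun_prop : Continuous fun p : E × I ↦ (p.2 : ℝ) • p.1)).clm_apply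
      continuous_fst
  change Continuous fun p : E × I ↦
    (p.2 : ℝ) • (fderiv ℝ A ((p.2 : ℝ) • p.1)).flip p.1 + A ((p.2 : ℝ) • p.1)
  fun_prop

theorem hasFDerivAt_rayCoeff (A : E → E →L[ℝ] R) (hA : ContDiff ℝ 1 A) (x : E) :
    HasFDerivAt (rayCoeff A hA.continuous) (familyApply (rayCoeffDeriv A hA x)) x := by
  refine hasFDerivAt_continuousMap (continuous_rayCoeffDeriv A hA) (fun x s ↦ ?_) x
  have h1 : HasFDerivAt (fun y : E ↦ (s : ℝ) • y) ((s : ℝ) • ContinuousLinearMap.id ℝ E) x :=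
    (hasFDerivAt_id x).const_smul (s : ℝ)
  have h2 : HasFDerivAt A (fderiv ℝ A ((s : ℝ) • x)) ((s : ℝ) • x) :=
    (hA.differentiable one_ne_zero _).hasFDerivAt
  have h3 := (h2.comp x h1).clm_apply (hasFDerivAt_id x)
  refine h3.congr_fderiv ?_
  ext h
  simp [rayCoeffDeriv, add_comm]

variable [CompleteSpace R]

/-- The Volterra operator of the equation along the ray to `x`. -/
def rayOperator (A : E → E →L[ℝ] R) (hA : Continuous A) (x : E) : C(I, R) →L[ℝ] C(I, R) :=
  integration ∘L ContinuousLinearMap.mul ℝ C(I, R) (rayCoeff A hA x)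

theorem hasFDerivAt_rayOperator (A : E → E →L[ℝ] R) (hA : ContDiff ℝ 1 A) (x : E) :
    HasFDerivAt (rayOperator A hA.continuous)
      ((ContinuousLinearMap.compL ℝ C(I, R) C(I, R) C(I, R) integration) ∘L
        ContinuousLinearMap.mul ℝ C(I, R) ∘L familyApply (rayCoeffDeriv A hA x)) x :=
  hasFDerivAt_comp_mul (C := C(I, R)) integration (hasFDerivAt_rayCoeff A hA x)

omit [CompleteSpace R] in
theorem rayCoeff_zero (A : E → E →L[ℝ] R) (hA : Continuous A) : rayCoeff A hA 0 = 0 := by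
  ext s
  simp [rayCoeff]

theorem rayOperator_zero (A : E → E →L[ℝ] R) (hA : Continuous A) : rayOperator A hA 0 = 0 := by
  simp [rayOperator, rayCoeff_zero]

/-- The solution along the ray to `x`. -/
def raySolution (A : E → E →L[ℝ] R) (hA : Continuous A) (x : E) : C(I, R) :=
  Ring.inverse (1 - rayOperator A hA x) 1

theorem raySolution_eq {A : E → E →L[ℝ] R} {hA : Continuous A} {x : E}
    (hx : ‖rayOperator A hA x‖ < 1) :
    raySolution A hA x = 1 + integration (rayCoeff A hA x * raySolution A hA x) :=
  inverse_one_sub_apply hx 1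

theorem exists_hasFDerivAt_raySolution {A : E → E →L[ℝ] R} (hA : ContDiff ℝ 1 A) {x : E}
    (hx : ‖rayOperator A hA.continuous x‖ < 1) :
    ∃ D : E →L[ℝ] C(I, R), HasFDerivAt (raySolution A hA.continuous) D x ∧
      ∀ h, D h = integration (rayCoeff A hA.continuous x * D h +
        familyApply (rayCoeffDeriv A hA x) h * raySolution A hA.continuous x) := by
  obtain ⟨D, hD, hD'⟩ := exists_hasFDerivAt_inverse_one_sub (hasFDerivAt_rayOperator A hA x) hx 1
  refine ⟨D, hD, fun h ↦ ?_⟩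
  rw [map_add]
  exact hD' h

omit [CompleteSpace R] in
theorem hasDerivAt_along_ray {A : E → E →L[ℝ] R} (hA : ContDiff ℝ 1 A) (x h : E) (s : ℝ) :
    HasDerivAt (fun s : ℝ ↦ A (s • x) h) (fderiv ℝ A (s • x) x h) s := by
  have h1 : HasDerivAt (fun s : ℝ ↦ s • x) ((1 : ℝ) • x) s := (hasDerivAt_id s).smul_const x
  have h2 : HasFDerivAt A (fderiv ℝ A (s • x)) (s • x) :=
    (hA.differentiable one_ne_zero _).hasFDerivAt
  have h3 := h2.comp_hasDerivAt s h1
  rw [one_smul] at h3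
  exact (ContinuousLinearMap.apply ℝ R h).hasFDerivAt.comp_hasDerivAt s h3

/-- The derivative `w` of the ray solution `u` in the direction `h` solves the linearized equation.
If `u s` is to be the value at `s • x` of a solution of `dX = A X`, then `w s` must be `s • A (s •
x) h * u s`. Flatness makes the difference of the two solve a homogeneous linear equation with
initial value zero, so it vanishes; `s = 1` gives the claim. -/
theorem raySolution_derivative {A : E → E →L[ℝ] R} (hA : ContDiff ℝ 1 A) {x : E}
    (flat : ∀ s ∈ Set.Icc (0 : ℝ) 1, ∀ u h, fderiv ℝ A (s • x) u h + A (s • x) h * A (s • x) u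
      = fderiv ℝ A (s • x) h u + A (s • x) u * A (s • x) h)
    (hx : ‖rayOperator A hA.continuous x‖ < 1) {h : E} {w : C(I, R)}
    (hw : w = integration (rayCoeff A hA.continuous x * w +
        familyApply (rayCoeffDeriv A hA x) h * raySolution A hA.continuous x)) :
    w 1 = A x h * raySolution A hA.continuous x 1 := by
  set u := raySolution A hA.continuous x with hu
  have hu1 := raySolution_eq hx
  rw [← hu] at hu1
  set B := rayCoeff A hA.continuous x with hB
  set U : ℝ → R := fun s ↦ 1 + primitive (B * u) s
  set W : ℝ → R := primitive (B * w + familyApply (rayCoeffDeriv A hA x) h * u)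
  have hU (s : I) : U s = u s := by
    conv_rhs => rw [hu1]
    rfl
  have hW (s : I) : W s = w s := by
    conv_rhs => rw [hw]
    rfl
  have hUd (s : I) : HasDerivAt U (A ((s : ℝ) • x) x * U s) s := by
    have := (hasDerivAt_primitive (B * u) s).const_add 1
    rw [Set.projIcc_val] at this
    rw [hU]
    exact this
  have hWd (s : I) : HasDerivAt W (A ((s : ℝ) • x) x * W s
      + ((s : ℝ) • fderiv ℝ A ((s : ℝ) • x) h x + A ((s : ℝ) • x) h) * U s) s := by
    have := hasDerivAt_primitive (B * w + familyApply (rayCoeffDeriv A hA x) h * u) s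
    rw [Set.projIcc_val] at this
    rw [hU, hW]
    exact this
  have hAd (s : ℝ) := hasDerivAt_along_ray hA x h s
  set S : ℝ → R := fun s ↦ W s - s • (A (s • x) h * U s)
  have hS (s : I) : HasDerivAt S (A ((s : ℝ) • x) x * S s) s := by
    have := (hWd s).sub ((hasDerivAt_id (s : ℝ)).smul ((hAd s).mul (hUd s)))
    refine this.congr_deriv ?_
    -- Flatness for the pair `x`, `h` exchanges the two orders of differentiation; all that remains
    -- of `S'` is `A (s • x) x * S`.
    have hf := congrArg (fun z ↦ (s : ℝ) • (z * U s)) (flat s s.2 x h)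
    simp only [add_mul, smul_add] at hf
    simp only [S, id, Pi.mul_apply, one_smul, mul_sub, add_mul, smul_add, smul_mul_assoc, mul_smul_comm,
      ← mul_assoc]
    rw [hf]
    abel
  -- Grönwall's inequality with the constant `‖B‖`, which bounds the coefficient along the ray.
  have hS0 := eq_zero_of_abs_deriv_le_mul_abs_self_of_eq_zero_right (f := S) (a := 0) (b := 1)
    (f' := fun s ↦ A (s • x) x * S s) (K := ‖B‖)
    (fun s hs ↦ (hS ⟨s, hs⟩).continuousAt.continuousWithinAt)
    (fun s hs ↦ (hS ⟨s, Set.Ico_subset_Icc_self hs⟩).hasDerivWithinAt) (by simp [S, W])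
    (fun s hs ↦ (norm_mul_le _ _).trans (by
      gcongr
      exact B.norm_coe_le_norm ⟨s, Set.Ico_subset_Icc_self hs⟩)) 1 (by simp)
  have e1 := hU 1
  have e2 := hW 1
  simp only [S, one_smul] at hS0
  rw [← e1, ← e2]
  simpa [sub_eq_zero] using hS0

/-- Frobenius' theorem for linear total differential equations `dX = A X` that are flat on a ball,
with globally defined coefficients. -/
theorem exists_solution_of_contDiff {A : E → E →L[ℝ] R} (hA : ContDiff ℝ 1 A) {r : ℝ} (hr : 0 < r)
    (flat : ∀ x ∈ Metric.ball (0 : E) r, ∀ u h, fderiv ℝ A x u h + A x h * A x u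
      = fderiv ℝ A x h u + A x u * A x h) :
    ∃ δ > 0, ∃ X : E → R, X 0 = 1 ∧ ∀ x ∈ Metric.ball (0 : E) δ,
      HasFDerivAt X ((ContinuousLinearMap.mul ℝ R).flip (X x) ∘L A x) x := by
  have hK : ContinuousAt (rayOperator A hA.continuous) 0 :=
    (hasFDerivAt_rayOperator A hA 0).continuousAt
  -- The Volterra operator is continuous in `x` and vanishes at `0`, so the Neumann series converges
  -- for small `x`.
  have hev : ∀ᶠ x in nhds 0, ‖rayOperator A hA.continuous x‖ < 1 :=
    eventually_norm_lt (F := C(I, R) →L[ℝ] C(I, R)) hK (rayOperator_zero A _) one_pos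
  obtain ⟨δ, hδ, H⟩ := Metric.eventually_nhds_iff_ball.1 hev
  simp only [mem_ball_zero_iff] at H
  refine ⟨min δ r, lt_min hδ hr, fun x ↦ raySolution A hA.continuous x 1, ?_, fun x hx ↦ ?_⟩
  · have : raySolution A hA.continuous 0 = 1 := by
      rw [raySolution_eq (H 0 (by simpa using hδ)), rayCoeff_zero, zero_mul, map_zero, add_zero]
    simp [this]
  · rw [mem_ball_zero_iff, lt_min_iff] at hx
    obtain ⟨D, hD, hD'⟩ := exists_hasFDerivAt_raySolution hA (H x hx.1)
    have := ((ContinuousMap.evalCLM ℝ (1 : I) : C(I, R) →L[ℝ] R).hasFDerivAt).comp x hD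
    refine this.congr_fderiv ?_
    ext h
    refine raySolution_derivative hA (fun s hs ↦ flat _ ?_) (H x hx.1) (hD' h)
    rw [mem_ball_zero_iff, norm_smul, Real.norm_of_nonneg hs.1]
    exact (mul_le_of_le_one_left (norm_nonneg x) hs.2).trans_lt hx.2

end Existence

end FlatSystem

/-! ### Smoothness of solutions, and Frobenius' theorem on open sets -/

namespace FlatSystem

/-- Bootstrapping: the equation expresses the derivative of `X` through `A` and `X`, so each order
of regularity of `X` yields the next. -/
theorem contDiffOn_of_hasFDerivAt_solution {E R : Type*} [NormedAddCommGroup E] [NormedSpace ℝ E]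
    [NormedRing R] [NormedAlgebra ℝ R] {A : E → E →L[ℝ] R} {U : Set E} (hU : IsOpen U)
    (hA : ContDiffOn ℝ ∞ A U) {X : E → R}
    (hX : ∀ x ∈ U, HasFDerivAt X ((ContinuousLinearMap.mul ℝ R).flip (X x) ∘L A x) x) :
    ContDiffOn ℝ ∞ X U := by
  rw [contDiffOn_infty]
  intro n
  induction n with
  | zero => exact contDiffOn_zero.2 fun x hx ↦ (hX x hx).continuousAt.continuousWithinAt
  | succ n ih =>
    rw [Nat.cast_succ, contDiffOn_succ_iff_fderiv_of_isOpen hU]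
    refine ⟨fun x hx ↦ (hX x hx).differentiableAt.differentiableWithinAt, by simp, ?_⟩
    have h1 : ContDiffOn ℝ n (fun x ↦ (ContinuousLinearMap.mul ℝ R).flip (X x) ∘L A x) U :=
      ((ContinuousLinearMap.mul ℝ R).flip.contDiff.comp_contDiffOn ih).clm_comp
        (hA.of_le (mod_cast le_top))
    exact h1.congr fun x hx ↦ (hX x hx).fderiv

/-- **Frobenius' theorem** for flat linear total differential equations `dX = A X`. -/
theorem exists_solution {E R : Type*} [NormedAddCommGroup E] [NormedSpace ℝ E]
    [FiniteDimensional ℝ E] [NormedRing R] [NormedAlgebra ℝ R] [CompleteSpace R]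
    {A : E → E →L[ℝ] R} {U : Set E} (hU : IsOpen U) {x₀ : E} (hx₀ : x₀ ∈ U)
    (hA : ContDiffOn ℝ ∞ A U)
    (flat : ∀ x ∈ U, ∀ u h, fderiv ℝ A x u h + A x h * A x u
      = fderiv ℝ A x h u + A x u * A x h) :
    ∃ δ > 0, Metric.ball x₀ δ ⊆ U ∧ ∃ X : E → R, X x₀ = 1 ∧
      ContDiffOn ℝ ∞ X (Metric.ball x₀ δ) ∧ ∀ x ∈ Metric.ball x₀ δ,
        HasFDerivAt X ((ContinuousLinearMap.mul ℝ R).flip (X x) ∘L A x) x := by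
  obtain ⟨r, hr, hrU⟩ := Metric.isOpen_iff.1 hU x₀ hx₀
  -- The cutoff makes the coefficients globally `C¹`. It equals `1` on the ball of radius `r / 3`,
  -- where flatness is retained, and its support lies inside the ball of radius `r`, where `A` is
  -- smooth.
  let f : ContDiffBump (0 : E) := ⟨r / 3, r / 2, by positivity, by linarith⟩
  have hshift : ∀ y ∈ Metric.ball (0 : E) r, x₀ + y ∈ U := fun y hy ↦
    hrU (by simpa using hy)
  have hAat : ∀ y ∈ Metric.ball (0 : E) r, ContDiffAt ℝ ∞ (fun y ↦ A (x₀ + y)) y := fun y hy ↦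
    (hA.contDiffAt (hU.mem_nhds (hshift y hy))).comp y
      (contDiffAt_const.add contDiffAt_id)
  let A' : E → E →L[ℝ] R := fun y ↦ f y • A (x₀ + y)
  have hA' : ContDiff ℝ 1 A' := by
    rw [contDiff_iff_contDiffAt]
    intro y
    by_cases hy : y ∈ Metric.ball (0 : E) r
    · exact (f.contDiffAt.smul (hAat y hy)).of_le (mod_cast le_top)
    · have h0 : ∀ᶠ z in nhds y, A' z = 0 := by
        have : ∀ᶠ z in nhds y, z ∈ (tsupport f)ᶜ := by
          refine (isClosed_tsupport f).isOpen_compl.mem_nhds ?_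
          rw [f.tsupport_eq]
          intro h
          simp only [Metric.mem_closedBall, Metric.mem_ball, f] at h hy
          linarith
        filter_upwards [this] with z hz
        simp only [A', image_eq_zero_of_notMem_tsupport hz]
        exact zero_smul ℝ (A (x₀ + z))
      exact contDiffAt_const.congr_of_eventuallyEq h0
  have hloc : ∀ y ∈ Metric.ball (0 : E) (r / 3), A' =ᶠ[nhds y] fun y ↦ A (x₀ + y) := by
    intro y hy
    filter_upwards [Metric.isOpen_ball.mem_nhds hy] with z hz
    have : f z = 1 := f.one_of_mem_closedBall (Metric.ball_subset_closedBall hz)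
    simp [A', this]
  have hfd : ∀ y ∈ Metric.ball (0 : E) (r / 3), fderiv ℝ A' y = fderiv ℝ A (x₀ + y) := by
    intro y hy
    rw [(hloc y hy).fderiv_eq, fderiv_comp_add_left]
  have hsub : Metric.ball (0 : E) (r / 3) ⊆ Metric.ball 0 r :=
    Metric.ball_subset_ball (by linarith)
  obtain ⟨δ, hδ, X, hX0, hX⟩ := exists_solution_of_contDiff hA' (r := r / 3) (by positivity)
    fun y hy u h ↦ by
      rw [hfd y hy, (hloc y hy).eq_of_nhds]
      exact flat _ (hshift y (hsub hy)) u h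
  have hbU : Metric.ball x₀ (min δ (r / 3)) ⊆ U :=
    (Metric.ball_subset_ball ((min_le_right _ _).trans (by linarith))).trans hrU
  have hder : ∀ x ∈ Metric.ball x₀ (min δ (r / 3)), HasFDerivAt (fun x ↦ X (x - x₀))
      ((ContinuousLinearMap.mul ℝ R).flip (X (x - x₀)) ∘L A x) x := by
    intro x hx
    rw [mem_ball_iff_norm, lt_min_iff] at hx
    have h1 := hX (x - x₀) (by simpa using hx.1)
    rw [(hloc (x - x₀) (by simpa using hx.2)).eq_of_nhds, add_sub_cancel] at h1
    exact (h1.comp x ((hasFDerivAt_id x).sub_const x₀)).congr_fderiv (by ext h; simp)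
  exact ⟨min δ (r / 3), by positivity, hbU, fun x ↦ X (x - x₀), by simpa using hX0,
    contDiffOn_of_hasFDerivAt_solution Metric.isOpen_ball (hA.mono hbU) hder, hder⟩

end FlatSystem

/-! ### Metrics of constant curvature on open subsets of a vector space -/

namespace LocalGeometry

variable {E : Type*} [NormedAddCommGroup E] [NormedSpace ℝ E]

/-- The curvature tensor of the connection `∂ + Γ`. -/
def curvature (Γ : E → E →L[ℝ] E →L[ℝ] E) (x u v w : E) : E :=
  fderiv ℝ Γ x u v w - fderiv ℝ Γ x v u w + Γ x u (Γ x v w) - Γ x v (Γ x u w)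

/-- `∂ + Γ` is the Levi-Civita connection of the smooth Riemannian metric `G` on the open
set `U`. -/
structure IsLeviCivitaOn (G : E → E →L[ℝ] E →L[ℝ] ℝ) (Γ : E → E →L[ℝ] E →L[ℝ] E)
    (U : Set E) : Prop where
  isOpen : IsOpen U
  contDiffOn_metric : ContDiffOn ℝ ∞ G U
  contDiffOn_connection : ContDiffOn ℝ ∞ Γ U
  symm : ∀ x ∈ U, ∀ u v, G x u v = G x v u
  pos : ∀ x ∈ U, ∀ u, u ≠ 0 → 0 < G x u u
  torsion : ∀ x ∈ U, ∀ u v, Γ x u v = Γ x v u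
  compat : ∀ x ∈ U, ∀ u v w, fderiv ℝ G x u v w = G x (Γ x u v) w + G x v (Γ x u w)

/-- A tensor with the symmetries of a curvature tensor is determined by its sectional
curvatures. -/
theorem eq_zero_of_sectional {V : Type*} [AddCommGroup V] (S : V → V → V → V → ℝ)
    (add₁ : ∀ a b u v w, S (a + b) u v w = S a u v w + S b u v w)
    (add₂ : ∀ a b u v w, S u (a + b) v w = S u a v w + S u b v w)
    (add₃ : ∀ a b u v w, S u v (a + b) w = S u v a w + S u v b w)
    (add₄ : ∀ a b u v w, S u v w (a + b) = S u v w a + S u v w b)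
    (anti₁₂ : ∀ u v w t, S u v w t = -S v u w t) (anti₃₄ : ∀ u v w t, S u v w t = -S u v t w)
    (bianchi : ∀ u v w t, S u v w t + S v w u t + S w u v t = 0)
    (sec : ∀ u w, S u w w u = 0) (u v w t : V) : S u v w t = 0 := by
  have pair : ∀ u v w t, S u v w t = S w t u v := by
    intro u v w t
    linarith [bianchi u v w t, bianchi v w t u, bianchi w t u v, bianchi t u v w,
      anti₁₂ u v w t, anti₁₂ v w u t, anti₁₂ w u v t, anti₁₂ v w t u, anti₁₂ w t v u,
      anti₁₂ t v w u, anti₁₂ w t u v, anti₁₂ t u w v, anti₁₂ u w t v, anti₁₂ t u v w,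
      anti₁₂ u v t w, anti₁₂ v t u w, anti₃₄ u v w t, anti₃₄ v w u t, anti₃₄ w u v t,
      anti₃₄ w t v u, anti₃₄ t v w u, anti₃₄ t u w v]
  -- Polarization of `sec` in the outer slots, where pair symmetry makes the two mixed terms equal.
  have h1 : ∀ u v t, S u v v t = 0 := by
    intro u v t
    have := sec (u + t) v
    rw [add₁, add₄, add₄, sec, sec] at this
    have h2 := pair t v v u
    have h3 := anti₁₂ v u t v
    have h4 := anti₃₄ u v t v
    linarith
  -- Polarization in the inner slots. Now `S` changes sign under exchange of any two of its first
  -- three arguments, so the three terms of the Bianchi identity coincide and `3 S = 0`.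
  have h2 : ∀ u v w t, S u v w t = -S u w v t := by
    intro u v w t
    have := h1 u (v + w) t
    rw [add₂, add₃, add₃, h1, h1] at this
    linarith
  linarith [bianchi u v w t, h2 u v w t, h2 v w u t, h2 w u v t, anti₁₂ u v w t, anti₁₂ v w u t,
    anti₁₂ w u v t, anti₁₂ u w v t, anti₁₂ v u w t]

namespace IsLeviCivitaOn

variable {G : E → E →L[ℝ] E →L[ℝ] ℝ} {Γ : E → E →L[ℝ] E →L[ℝ] E} {U : Set E}

theorem hasFDerivAt_metric (h : IsLeviCivitaOn G Γ U) {x : E} (hx : x ∈ U) :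
    HasFDerivAt G (fderiv ℝ G x) x :=
  ((h.contDiffOn_metric.contDiffAt (h.isOpen.mem_nhds hx)).differentiableAt (by simp)).hasFDerivAt

theorem hasFDerivAt_connection (h : IsLeviCivitaOn G Γ U) {x : E} (hx : x ∈ U) :
    HasFDerivAt Γ (fderiv ℝ Γ x) x :=
  ((h.contDiffOn_connection.contDiffAt (h.isOpen.mem_nhds hx)).differentiableAt
    (by simp)).hasFDerivAt

theorem contDiffAt_metric_apply (h : IsLeviCivitaOn G Γ U) {x : E} (hx : x ∈ U) (v w : E) :
    ContDiffAt ℝ ∞ (fun y ↦ G y v w) x :=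
  ((h.contDiffOn_metric.contDiffAt (h.isOpen.mem_nhds hx)).clm_apply contDiffAt_const).clm_apply
    contDiffAt_const

theorem fderiv_metric_apply (h : IsLeviCivitaOn G Γ U) {x : E} (hx : x ∈ U) (u v w : E) :
    fderiv ℝ (fun y ↦ G y v w) x u = G x (Γ x u v) w + G x v (Γ x u w) := by
  have e1 := ((h.hasFDerivAt_metric hx).clm_apply (hasFDerivAt_const v x)).clm_apply
    (hasFDerivAt_const w x)
  rw [e1.fderiv, ← h.compat x hx]
  simp

theorem second_deriv_metric (h : IsLeviCivitaOn G Γ U) {x : E} (hx : x ∈ U) (z u v w : E) :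
    fderiv ℝ (fderiv ℝ fun y ↦ G y v w) x z u
      = G x (Γ x z (Γ x u v)) w + G x (Γ x u v) (Γ x z w) + G x (fderiv ℝ Γ x z u v) w
      + G x (Γ x z v) (Γ x u w) + G x v (Γ x z (Γ x u w)) + G x v (fderiv ℝ Γ x z u w) := by
  have hG := h.hasFDerivAt_metric hx
  have hΓ := h.hasFDerivAt_connection hx
  have hG2 : HasFDerivAt (fderiv ℝ fun y ↦ G y v w) (fderiv ℝ (fderiv ℝ fun y ↦ G y v w) x) x :=
    (((h.contDiffAt_metric_apply hx v w).fderiv_right (m := 1) (WithTop.coe_le_coe.2 le_top)).differentiableAt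
      one_ne_zero).hasFDerivAt
  have cst : ∀ a : E, HasFDerivAt (fun _ : E ↦ a) (0 : E →L[ℝ] E) x := fun a ↦
    hasFDerivAt_const a x
  have e1 := hG2.clm_apply (cst u)
  have e2 := ((hG.clm_apply ((hΓ.clm_apply (cst u)).clm_apply (cst v))).clm_apply (cst w)).add
    ((hG.clm_apply (cst v)).clm_apply ((hΓ.clm_apply (cst u)).clm_apply (cst w)))
  have hev : (fun y ↦ fderiv ℝ (fun y ↦ G y v w) y u) =ᶠ[nhds x]
      (fun y ↦ G y (Γ y u v) w) + fun y ↦ G y v (Γ y u w) := by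
    filter_upwards [h.isOpen.mem_nhds hx] with y hy using h.fderiv_metric_apply hy u v w
  have e3 := congrArg (fun T : E →L[ℝ] ℝ ↦ T z) (e1.unique (e2.congr_of_eventuallyEq hev))
  simp [h.compat x hx] at e3
  linarith

/-- This is the symmetry of second derivatives of `y ↦ G y v w`: expanded by metric compatibility,
the terms with one connection factor on each argument cancel on exchanging `z` and `u`, and
curvature terms remain. -/
theorem metric_curvature_antisymm (h : IsLeviCivitaOn G Γ U) {x : E} (hx : x ∈ U) (z u v w : E) :
    G x (curvature Γ x z u v) w = -G x (curvature Γ x z u w) v := by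
  have hs : fderiv ℝ (fderiv ℝ fun y ↦ G y v w) x z u = fderiv ℝ (fderiv ℝ fun y ↦ G y v w) x u z :=
    (h.contDiffAt_metric_apply hx v w).isSymmSndFDerivAt (by simpa using ENat.LEInfty.out) z u
  rw [h.second_deriv_metric hx, h.second_deriv_metric hx] at hs
  rw [h.symm x hx _ v]
  simp only [curvature, map_add, map_sub, add_apply, sub_apply]
  linarith

theorem fderiv_connection_symm (h : IsLeviCivitaOn G Γ U) {x : E} (hx : x ∈ U) (z u v : E) :
    fderiv ℝ Γ x z u v = fderiv ℝ Γ x z v u := by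
  have hΓ := h.hasFDerivAt_connection hx
  have cst : ∀ a : E, HasFDerivAt (fun _ : E ↦ a) (0 : E →L[ℝ] E) x := fun a ↦
    hasFDerivAt_const a x
  have e1 := (hΓ.clm_apply (cst u)).clm_apply (cst v)
  have e2 := (hΓ.clm_apply (cst v)).clm_apply (cst u)
  have hev : (fun y ↦ Γ y u v) =ᶠ[nhds x] fun y ↦ Γ y v u := by
    filter_upwards [h.isOpen.mem_nhds hx] with y hy using h.torsion y hy u v
  have e3 := congrArg (fun T : E →L[ℝ] E ↦ T z) (e1.unique (e2.congr_of_eventuallyEq hev))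
  simpa using e3

theorem curvature_bianchi (h : IsLeviCivitaOn G Γ U) {x : E} (hx : x ∈ U) (u v w : E) :
    curvature Γ x u v w + curvature Γ x v w u + curvature Γ x w u v = 0 := by
  simp only [curvature]
  rw [h.fderiv_connection_symm hx u w v, h.fderiv_connection_symm hx v u w,
    h.fderiv_connection_symm hx w v u, h.torsion x hx w v, h.torsion x hx u w,
    h.torsion x hx v u]
  abel

/-- If all sectional curvatures at `x` are `-1`, then the curvature tensor is that of hyperbolic
space. -/
theorem curvature_eq (h : IsLeviCivitaOn G Γ U) {x : E} (hx : x ∈ U)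
    (sec : ∀ u w, LinearIndependent ℝ ![u, w] →
      G x (curvature Γ x u w w) u / (G x u u * G x w w - G x u w ^ 2) = -1) (u v w : E) :
    curvature Γ x u v w = G x u w • v - G x v w • u := by
  have hsec : ∀ u w, G x (curvature Γ x u w w) u + (G x w w * G x u u - G x u w * G x w u) = 0 := by
    intro u w
    by_cases hl : LinearIndependent ℝ ![u, w]
    · have h1 := sec u w hl
      -- No Cauchy–Schwarz argument is needed: a zero denominator would make the quotient `0`, not
      -- `-1`.
      have h2 : G x u u * G x w w - G x u w ^ 2 ≠ 0 := by
        intro h0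
        rw [h0, div_zero] at h1
        norm_num at h1
      rw [div_eq_iff h2] at h1
      rw [h1, h.symm x hx w u]
      ring
    · rw [LinearIndependent.pair_iff] at hl
      push Not at hl
      obtain ⟨a, b, hab, hne⟩ := hl
      by_cases ha : a = 0
      · have hb : b ≠ 0 := hne ha
        have hw : w = 0 := by simpa [ha, hb] using hab
        simp [hw, curvature]
      · have hu : u = (-(b / a)) • w := by
          have : a • u = -(b • w) := eq_neg_of_add_eq_zero_left hab
          rw [← inv_smul_smul₀ ha u, this, smul_neg, smul_smul, neg_smul, div_eq_inv_mul]
        have h0 : curvature Γ x u w w = 0 := by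
          simp [hu, curvature]
        rw [h0, hu]
        simp
        ring
  -- Applied to the difference between the given curvature tensor and that of curvature `-1`.
  have hS := eq_zero_of_sectional
    (fun u v w t ↦ G x (curvature Γ x u v w) t + (G x v w * G x u t - G x u w * G x v t))
    (by intros; simp [curvature]; ring) (by intros; simp [curvature]; ring)
    (by intros; simp [curvature]; ring) (by intros; simp; ring)
    (by intros; simp [curvature]; ring)
    (by
      intro u v w t
      simp only [h.metric_curvature_antisymm hx u v w t]
      ring)
    (by
      intro u v w t
      have h1 := congrArg (fun z ↦ G x z t) (h.curvature_bianchi hx u v w)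
      simp only [map_add, add_apply, map_zero, zero_apply] at h1
      rw [h.symm x hx v u, h.symm x hx w u, h.symm x hx w v]
      linarith)
    (fun u w ↦ hsec u w)
  have key : ∀ t, G x (curvature Γ x u v w - (G x u w • v - G x v w • u)) t = 0 := by
    intro t
    have := hS u v w t
    simp at this ⊢
    linarith
  by_contra hne
  exact (h.pos x hx _ (sub_ne_zero.2 hne)).ne' (key _)

end IsLeviCivitaOn

end LocalGeometry

/-! ### The equation `Hess f = f G` and the immersion into the hyperboloid -/

namespace LocalGeometry

variable {E : Type*} [NormedAddCommGroup E] [NormedSpace ℝ E]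

/-- The linear connection on `ℝ × E` whose parallel sections are the pairs `(f, grad f)` with
`Hess f = f G`, as a linear total differential equation. -/
def hessianSystem (G : E → E →L[ℝ] E →L[ℝ] ℝ) (Γ : E → E →L[ℝ] E →L[ℝ] E) (x : E) :
    E →L[ℝ] (ℝ × E) →L[ℝ] (ℝ × E) :=
  (ContinuousLinearMap.compL ℝ (ℝ × E) ℝ (ℝ × E) (ContinuousLinearMap.inl ℝ ℝ E) ∘L
    (ContinuousLinearMap.compL ℝ (ℝ × E) E ℝ).flip (ContinuousLinearMap.snd ℝ ℝ E)) ∘L G x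
  - (ContinuousLinearMap.compL ℝ (ℝ × E) E (ℝ × E) (ContinuousLinearMap.inr ℝ ℝ E) ∘L
    (ContinuousLinearMap.compL ℝ (ℝ × E) E E).flip (ContinuousLinearMap.snd ℝ ℝ E)) ∘L Γ x
  + ContinuousLinearMap.compL ℝ (ℝ × E) E (ℝ × E) (ContinuousLinearMap.inr ℝ ℝ E) ∘L
    ContinuousLinearMap.smulRightL ℝ (ℝ × E) E (ContinuousLinearMap.fst ℝ ℝ E)

theorem hessianSystem_apply (G : E → E →L[ℝ] E →L[ℝ] ℝ) (Γ : E → E →L[ℝ] E →L[ℝ] E) (x h : E)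
    (ψ : ℝ × E) : hessianSystem G Γ x h ψ = (G x h ψ.2, ψ.1 • h - Γ x h ψ.2) := by
  simp [hessianSystem, sub_eq_neg_add]

/-- The Lorentzian form on the bundle `ℝ × E`. -/
def form (G : E → E →L[ℝ] E →L[ℝ] ℝ) (x : E) (ψ ψ' : ℝ × E) : ℝ := G x ψ.2 ψ'.2 - ψ.1 * ψ'.1

/-- The family of maps `Φ` solves the Hessian system at `x`. -/
def IsParallelAt (G : E → E →L[ℝ] E →L[ℝ] ℝ) (Γ : E → E →L[ℝ] E →L[ℝ] E)
    (Φ : E → (ℝ × E) →L[ℝ] (ℝ × E)) (x : E) : Prop :=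
  ∀ ψ, HasFDerivAt (fun y ↦ Φ y ψ) ((hessianSystem G Γ x).flip (Φ x ψ)) x

namespace IsLeviCivitaOn

variable {G : E → E →L[ℝ] E →L[ℝ] ℝ} {Γ : E → E →L[ℝ] E →L[ℝ] E} {U : Set E}

theorem contDiffOn_hessianSystem (h : IsLeviCivitaOn G Γ U) :
    ContDiffOn ℝ ∞ (hessianSystem G Γ) U :=
  ((contDiffOn_const.clm_comp h.contDiffOn_metric).sub
    (contDiffOn_const.clm_comp h.contDiffOn_connection)).add contDiffOn_const

set_option synthInstance.maxHeartbeats 200000 in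
theorem fderiv_hessianSystem (h : IsLeviCivitaOn G Γ U) {x : E} (hx : x ∈ U) (u v : E)
    (ψ : ℝ × E) : fderiv ℝ (hessianSystem G Γ) x u v ψ
      = (fderiv ℝ G x u v ψ.2, -fderiv ℝ Γ x u v ψ.2) := by
  have cst : ∀ {F : Type _} [NormedAddCommGroup F] [NormedSpace ℝ F] (a : F),
      HasFDerivAt (fun _ : E ↦ a) (0 : E →L[ℝ] F) x := fun a ↦ hasFDerivAt_const a x
  have e0 : HasFDerivAt (hessianSystem G Γ) (fderiv ℝ (hessianSystem G Γ) x) x :=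
    ((h.contDiffOn_hessianSystem.contDiffAt (h.isOpen.mem_nhds hx)).differentiableAt
      (by simp)).hasFDerivAt
  have e1 := (e0.clm_apply (cst v)).clm_apply (cst ψ)
  have hG := ((h.hasFDerivAt_metric hx).clm_apply (cst v)).clm_apply (cst ψ.2)
  have hΓ := ((h.hasFDerivAt_connection hx).clm_apply (cst v)).clm_apply (cst ψ.2)
  have e2 := hG.prodMk (hΓ.const_sub (ψ.1 • v))
  simp only [← hessianSystem_apply G Γ _ v ψ] at e2
  have e3 := congrArg (fun T : E →L[ℝ] ℝ × E ↦ T u) (e1.unique e2)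
  simpa using e3

/-- In the scalar component, flatness reduces to metric compatibility, vanishing torsion and the
symmetry of `G`. In the vector component the obstruction is the curvature, and the commutator of the
terms `f h` cancels it exactly when the curvature is `-1`. -/
theorem hessianSystem_flat (h : IsLeviCivitaOn G Γ U) {x : E} (hx : x ∈ U)
    (hc : ∀ u v w, curvature Γ x u v w = G x u w • v - G x v w • u) (u v : E) :
    fderiv ℝ (hessianSystem G Γ) x u v + hessianSystem G Γ x v * hessianSystem G Γ x u
      = fderiv ℝ (hessianSystem G Γ) x v u + hessianSystem G Γ x u * hessianSystem G Γ x v := by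
  refine ContinuousLinearMap.ext fun ψ ↦ ?_
  rw [add_apply, add_apply, mul_apply_eq_comp, mul_apply_eq_comp, h.fderiv_hessianSystem hx,
    h.fderiv_hessianSystem hx]
  simp only [hessianSystem_apply, Prod.mk_add_mk, Prod.mk.injEq]
  constructor
  · rw [h.compat x hx, h.compat x hx, h.torsion x hx v u]
    simp only [map_sub, map_smul, smul_eq_mul]
    rw [h.symm x hx v u]
    ring
  · have := hc u v ψ.2
    rw [curvature] at this
    have h2 : fderiv ℝ Γ x u v ψ.2 = G x u ψ.2 • v - G x v ψ.2 • u + fderiv ℝ Γ x v u ψ.2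
        - Γ x u (Γ x v ψ.2) + Γ x v (Γ x u ψ.2) := by
      rw [← this]
      abel
    rw [h2]
    simp only [map_sub, map_smul, h.torsion x hx v u]
    abel

/-- In constant curvature `-1`, the Hessian system has a local fundamental solution. -/
theorem exists_isParallelAt [FiniteDimensional ℝ E] (h : IsLeviCivitaOn G Γ U)
    (hc : ∀ x ∈ U, ∀ u v w, curvature Γ x u v w = G x u w • v - G x v w • u) {x₀ : E}
    (hx₀ : x₀ ∈ U) :
    ∃ δ > 0, Metric.ball x₀ δ ⊆ U ∧ ∃ Φ : E → (ℝ × E) →L[ℝ] (ℝ × E), Φ x₀ = 1 ∧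
      ContDiffOn ℝ ∞ Φ (Metric.ball x₀ δ) ∧ ∀ x ∈ Metric.ball x₀ δ, IsParallelAt G Γ Φ x := by
  obtain ⟨δ, hδ, hU, Φ, h0, hs, hd⟩ := FlatSystem.exists_solution h.isOpen hx₀
    h.contDiffOn_hessianSystem fun x hx ↦ h.hessianSystem_flat hx (hc x hx)
  refine ⟨δ, hδ, hU, Φ, h0, hs, fun x hx ψ ↦ ?_⟩
  have := (hd x hx).clm_apply (hasFDerivAt_const ψ x)
  refine this.congr_fderiv ?_
  refine ContinuousLinearMap.ext fun v ↦ ?_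
  simp

/-- For parallel `(f, Z)` and `(f', Z')`, compatibility gives `d G(Z, Z') = f G(·, Z') + f' G(Z,
·)`, which is `d(f f')`. The form therefore has zero derivative on the connected ball. -/
theorem form_eq_of_isParallelAt (h : IsLeviCivitaOn G Γ U) {x₀ : E} {δ : ℝ} (hδ : 0 < δ)
    (hU : Metric.ball x₀ δ ⊆ U) {Φ : E → (ℝ × E) →L[ℝ] (ℝ × E)}
    (hΦ : ∀ x ∈ Metric.ball x₀ δ, IsParallelAt G Γ Φ x) (ψ ψ' : ℝ × E) {x : E}
    (hx : x ∈ Metric.ball x₀ δ) :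
    form G x (Φ x ψ) (Φ x ψ') = form G x₀ (Φ x₀ ψ) (Φ x₀ ψ') := by
  have hd : ∀ y ∈ Metric.ball x₀ δ, HasFDerivAt (fun y ↦ form G y (Φ y ψ) (Φ y ψ'))
      (0 : E →L[ℝ] ℝ) y := by
    intro y hy
    have h1 := hΦ y hy ψ
    have h2 := hΦ y hy ψ'
    have e := (((h.hasFDerivAt_metric (hU hy)).clm_apply h1.snd).clm_apply h2.snd).sub
      (h1.fst.mul h2.fst)
    refine e.congr_fderiv ?_
    refine ContinuousLinearMap.ext fun v ↦ ?_
    simp [hessianSystem_apply, h.compat y (hU hy)]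
    rw [h.symm y (hU hy) _ v]
    ring
  exact Metric.isOpen_ball.is_const_of_fderiv_eq_zero (convex_ball x₀ δ).isPreconnected
    (fun y hy ↦ (hd y hy).differentiableAt.differentiableWithinAt) (fun y hy ↦ (hd y hy).fderiv)
    hx (Metric.mem_ball_self hδ)

/-- Parseval's identity: an orthonormal family with as many members as the dimension is a basis. -/
theorem apply_eq_sum (h : IsLeviCivitaOn G Γ U) {x : E} (hx : x ∈ U) {ι : Type*} [Fintype ι]
    [DecidableEq ι] [FiniteDimensional ℝ E] (hι : Fintype.card ι = Module.finrank ℝ E)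
    {w : ι → E} (hw : ∀ i j, G x (w i) (w j) = if i = j then 1 else 0) (u v : E) :
    G x u v = ∑ i, G x u (w i) * G x v (w i) := by
  have hli : LinearIndependent ℝ w := by
    rw [Fintype.linearIndependent_iff]
    intro c hc i
    have := congrArg (fun z ↦ G x z (w i)) hc
    simpa [map_sum, hw] using this
  have hspan := hli.span_eq_top_of_card_eq_finrank' hι
  have hu : u ∈ Submodule.span ℝ (Set.range w) := hspan ▸ Submodule.mem_top
  obtain ⟨c, rfl⟩ := (Submodule.mem_span_range_iff_exists_fun ℝ).1 hu
  simp [map_sum, hw, h.symm x hx v]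

/-- The expansion of the Lorentzian form in a parallel orthonormal frame. -/
theorem form_eq_sum (h : IsLeviCivitaOn G Γ U) {x₀ : E} {δ : ℝ} (hδ : 0 < δ)
    (hU : Metric.ball x₀ δ ⊆ U) {Φ : E → (ℝ × E) →L[ℝ] (ℝ × E)} (h0 : Φ x₀ = 1)
    (hΦ : ∀ x ∈ Metric.ball x₀ δ, IsParallelAt G Γ Φ x) {ι : Type*} [Fintype ι]
    [DecidableEq ι] [FiniteDimensional ℝ E] (hι : Fintype.card ι = Module.finrank ℝ E)
    {w : ι → E} (hw : ∀ i j, G x₀ (w i) (w j) = if i = j then 1 else 0) {x : E}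
    (hx : x ∈ Metric.ball x₀ δ) (ψ ψ' : ℝ × E) :
    form G x ψ ψ' = ∑ i, form G x ψ (Φ x (0, w i)) * form G x ψ' (Φ x (0, w i))
      - form G x ψ (Φ x (1, 0)) * form G x ψ' (Φ x (1, 0)) := by
  have hf : ∀ ψ ψ', form G x (Φ x ψ) (Φ x ψ') = form G x₀ ψ ψ' := fun ψ ψ' ↦ by
    rw [h.form_eq_of_isParallelAt hδ hU hΦ ψ ψ' hx, h0]
    rfl
  have hx₀ : x₀ ∈ U := hU (Metric.mem_ball_self hδ)
  have hinj : Function.Injective (Φ x) := by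
    rw [injective_iff_map_eq_zero]
    intro ξ hξ
    -- Flipping the sign of the time component turns the Lorentzian form into the positive definite
    -- `G (ξ.2, ξ.2) + ξ.1²`, so an isometry has trivial kernel even though the form is indefinite.
    have h1 := hf ξ (-ξ.1, ξ.2)
    rw [hξ] at h1
    simp only [form, Prod.fst_zero, Prod.snd_zero, map_zero, zero_apply, zero_mul,
      sub_zero] at h1
    have h2 : ξ.2 = 0 := by
      by_contra hne
      have := h.pos x₀ hx₀ _ hne
      nlinarith [sq_nonneg ξ.1]
    rw [h2] at h1
    simp only [map_zero] at h1
    have h3 : ξ.1 = 0 := by nlinarith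
    exact Prod.ext h3 h2
  have hsurj : Function.Surjective (Φ x) :=
    LinearMap.surjective_of_injective (f := (Φ x : (ℝ × E) →ₗ[ℝ] (ℝ × E))) hinj
  obtain ⟨ξ, rfl⟩ := hsurj ψ
  obtain ⟨ξ', rfl⟩ := hsurj ψ'
  simp only [hf]
  simp only [form, map_zero]
  rw [h.apply_eq_sum hx₀ hι hw ξ.2 ξ'.2]
  simp

/-- A Riemannian manifold of constant curvature `-1` is locally immersed isometrically into the
hyperboloid in Minkowski space, with prescribed orthonormal frame at one point. -/
theorem exists_hyperboloid_immersion [FiniteDimensional ℝ E] (h : IsLeviCivitaOn G Γ U)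
    (hc : ∀ x ∈ U, ∀ u v w, curvature Γ x u v w = G x u w • v - G x v w • u) {x₀ : E}
    (hx₀ : x₀ ∈ U) {ι : Type*} [Fintype ι] [DecidableEq ι]
    (hι : Fintype.card ι = Module.finrank ℝ E) {w : ι → E}
    (hw : ∀ i j, G x₀ (w i) (w j) = if i = j then 1 else 0) :
    ∃ V : Set E, IsOpen V ∧ x₀ ∈ V ∧ V ⊆ U ∧ ∃ (a : E → ℝ) (b : ι → E → ℝ),
      ContDiffOn ℝ ∞ a V ∧ (∀ i, ContDiffOn ℝ ∞ (b i) V) ∧ a x₀ = 1 ∧ (∀ i, b i x₀ = 0) ∧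
      fderiv ℝ a x₀ = 0 ∧ (∀ i j, fderiv ℝ (b i) x₀ (w j) = if i = j then 1 else 0) ∧
      ∀ x ∈ V, ∑ i, b i x ^ 2 - a x ^ 2 = -1 ∧
        (∀ u, ∑ i, b i x * fderiv ℝ (b i) x u - a x * fderiv ℝ a x u = 0) ∧
        ∀ u v, G x u v = ∑ i, fderiv ℝ (b i) x u * fderiv ℝ (b i) x v
          - fderiv ℝ a x u * fderiv ℝ a x v := by
  obtain ⟨δ, hδ, hU, Φ, h0, hs, hΦ⟩ := h.exists_isParallelAt hc hx₀
  have hfd : ∀ ψ, ∀ x ∈ Metric.ball x₀ δ, ∀ u, fderiv ℝ (fun y ↦ (Φ y ψ).1) x u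
      = form G x (0, u) (Φ x ψ) := by
    intro ψ x hx u
    rw [(hΦ x hx ψ).fst.fderiv]
    simp [hessianSystem_apply, form]
  have hval : ∀ ψ x, form G x (1, 0) (Φ x ψ) = -(Φ x ψ).1 := by
    intro ψ x
    simp [form]
  have hx₀' : x₀ ∈ Metric.ball x₀ δ := Metric.mem_ball_self hδ
  have hexp := fun x hx ψ ψ' ↦ h.form_eq_sum hδ hU h0 hΦ hι hw (x := x) hx ψ ψ'
  refine ⟨Metric.ball x₀ δ, Metric.isOpen_ball, hx₀', hU, fun y ↦ (Φ y (1, 0)).1,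
    fun i y ↦ (Φ y (0, w i)).1, (hs.clm_apply contDiffOn_const).fst,
    fun i ↦ (hs.clm_apply contDiffOn_const).fst, by simp [h0], by simp [h0], ?_, ?_, ?_⟩
  · ext u
    rw [hfd _ _ hx₀', h0]
    simp [form]
  · intro i j
    rw [hfd _ _ hx₀', h0]
    simp [form, hw, eq_comm]
  · intro x hx
    -- Pairing a parallel section with `(1, 0)` gives minus its function and pairing it with `(0,
    -- u)` gives the derivative of that function. The three identities are the frame expansion for
    -- `(1,0),(1,0)`, for `(1,0),(0,u)` and for `(0,u),(0,v)`.
    refine ⟨?_, fun u ↦ ?_, fun u v ↦ ?_⟩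
    · have := hexp x hx (1, 0) (1, 0)
      simp only [hval] at this
      simp only [form, map_zero, mul_one] at this
      rw [zero_sub] at this
      rw [this]
      simp [pow_two]
    · have := hexp x hx (1, 0) (0, u)
      simp only [hval, ← hfd _ _ hx] at this
      simp [form] at this
      linarith
    · have := hexp x hx (0, u) (0, v)
      simp only [← hfd _ _ hx] at this
      simpa [form] using this

end IsLeviCivitaOn

end LocalGeometry

/-! ### Horospherical coordinates on the hyperboloid -/

namespace LocalGeometry

/-- The coefficients of the hyperbolic metric `dz_o² + e^{-2 z_o} ∑_{i ≠ o} dz_i²`. -/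
def horosphericalCoeff {ι : Type*} [DecidableEq ι] (o i : ι) (z : EuclideanSpace ℝ ι) : ℝ :=
  if i = o then 1 else Real.exp (-2 * z o)

theorem horosphericalCoeff_pos {ι : Type*} [DecidableEq ι] (o i : ι) (z : EuclideanSpace ℝ ι) :
    0 < horosphericalCoeff o i z := by
  unfold horosphericalCoeff
  split_ifs <;> positivity

variable {E : Type*} [NormedAddCommGroup E] [NormedSpace ℝ E]

/-- The metric induced from Minkowski space on the hyperboloid, in horospherical coordinates. -/
theorem sum_horospherical {ι : Type*} [Fintype ι] [DecidableEq ι] (o : ι) (b β β' : ι → ℝ)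
    (a α α' : ℝ) (hpos : a - b o ≠ 0) (h : ∑ i, b i ^ 2 - a ^ 2 = -1)
    (hβ : ∑ i, b i * β i - a * α = 0) (hβ' : ∑ i, b i * β' i - a * α' = 0) :
    ∑ i, β i * β' i - α * α' = (α - β o) / (a - b o) * ((α' - β' o) / (a - b o))
      + ∑ i ∈ Finset.univ.erase o, (a - b o) ^ 2
        * (β i / (a - b o) - b i * (α - β o) / (a - b o) ^ 2)
        * (β' i / (a - b o) - b i * (α' - β' o) / (a - b o) ^ 2) := by
  rw [← Finset.add_sum_erase _ _ (Finset.mem_univ o)] at h hβ hβ' ⊢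
  set w := a - b o with hw
  -- Once expanded, the summands involve `i` only through `b i ^ 2`, `b i * β i`, `b i * β' i` and
  -- `β i * β' i`. The sums of the first three are eliminated by the hyperboloid equation and its
  -- differential.
  have e : ∀ i, w ^ 2 * (β i / w - b i * (α - β o) / w ^ 2)
        * (β' i / w - b i * (α' - β' o) / w ^ 2) = β i * β' i - (α' - β' o) / w * (b i * β i)
        - (α - β o) / w * (b i * β' i) + (α - β o) * (α' - β' o) / w ^ 2 * b i ^ 2 := by
    intro i
    field_simp
    ring
  simp only [e, Finset.sum_add_distrib, Finset.sum_sub_distrib, ← Finset.mul_sum]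
  have e1 : ∑ i ∈ Finset.univ.erase o, b i ^ 2 = a ^ 2 - b o ^ 2 - 1 := by linarith
  have e2 : ∑ i ∈ Finset.univ.erase o, b i * β i = a * α - b o * β o := by linarith
  have e3 : ∑ i ∈ Finset.univ.erase o, b i * β' i = a * α' - b o * β' o := by linarith
  rw [e1, e2, e3]
  have ha : a = w + b o := by rw [hw]; ring
  rw [ha]
  field_simp
  ring

/-- Horospherical coordinates in terms of the coordinates of Minkowski space. -/
def horosphericalMap {ι : Type*} [DecidableEq ι] (o : ι) (a : E → ℝ) (b : ι → E → ℝ) (x : E) :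
    EuclideanSpace ℝ ι :=
  WithLp.toLp 2 fun i ↦
    if i = o then -Real.log (a x - b o x) else b i x / (a x - b o x)

theorem hasFDerivAt_horosphericalMap {ι : Type*} [Fintype ι] [DecidableEq ι] (o : ι) {a : E → ℝ}
    {b : ι → E → ℝ} {x : E} (ha : DifferentiableAt ℝ a x) (hb : ∀ i, DifferentiableAt ℝ (b i) x)
    (hpos : a x - b o x ≠ 0) : ∃ D : E →L[ℝ] EuclideanSpace ℝ ι,
      HasFDerivAt (horosphericalMap o a b) D x ∧ ∀ u i, D u i =
        if i = o then -((fderiv ℝ a x u - fderiv ℝ (b o) x u) / (a x - b o x))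
        else fderiv ℝ (b i) x u / (a x - b o x)
          - b i x * (fderiv ℝ a x u - fderiv ℝ (b o) x u) / (a x - b o x) ^ 2 := by
  have hw : HasFDerivAt (fun x ↦ a x - b o x) (fderiv ℝ a x - fderiv ℝ (b o) x) x :=
    ha.hasFDerivAt.sub (hb o).hasFDerivAt
  have hi : ∀ i, ∃ D : E →L[ℝ] ℝ, HasFDerivAt (fun x ↦ horosphericalMap o a b x i) D x ∧
      ∀ u, D u = if i = o then -((fderiv ℝ a x u - fderiv ℝ (b o) x u) / (a x - b o x))
        else fderiv ℝ (b i) x u / (a x - b o x)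
          - b i x * (fderiv ℝ a x u - fderiv ℝ (b o) x u) / (a x - b o x) ^ 2 := by
    intro i
    by_cases hio : i = o
    · simp only [horosphericalMap, if_pos hio]
      refine ⟨_, (hw.log hpos).neg, fun u ↦ ?_⟩
      simp
      ring
    · simp only [horosphericalMap, if_neg hio, div_eq_mul_inv (b i _)]
      refine ⟨_, (hb i).hasFDerivAt.mul ((hasDerivAt_inv hpos).comp_hasFDerivAt x hw), fun u ↦ ?_⟩
      simp
      field_simp
      ring
  choose D hD hD' using hi
  refine ⟨(EuclideanSpace.equiv ι ℝ).symm.toContinuousLinearMap ∘L ContinuousLinearMap.pi D, ?_,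
    fun u i ↦ hD' i u⟩
  rw [← hasFDerivWithinAt_univ, hasFDerivWithinAt_euclidean]
  exact fun i ↦ (hD i).hasFDerivWithinAt

theorem contDiffOn_horosphericalMap {ι : Type*} [Fintype ι] [DecidableEq ι] (o : ι) {a : E → ℝ}
    {b : ι → E → ℝ} {V : Set E} (ha : ContDiffOn ℝ ∞ a V) (hb : ∀ i, ContDiffOn ℝ ∞ (b i) V)
    (hpos : ∀ x ∈ V, a x - b o x ≠ 0) : ContDiffOn ℝ ∞ (horosphericalMap o a b) V := by
  rw [contDiffOn_euclidean]
  intro i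
  by_cases hio : i = o
  · simp only [horosphericalMap, if_pos hio]
    exact ((ha.sub (hb o)).log hpos).neg
  · simp only [horosphericalMap, if_neg hio]
    exact (hb i).div (ha.sub (hb o)) hpos

namespace IsLeviCivitaOn

variable {G : E → E →L[ℝ] E →L[ℝ] ℝ} {Γ : E → E →L[ℝ] E →L[ℝ] E} {U : Set E}

/-- In constant curvature `-1`, there is a local isometry to hyperbolic space in horospherical
coordinates, with prescribed orthonormal frame at one point. -/
theorem exists_horospherical_immersion [FiniteDimensional ℝ E] (h : IsLeviCivitaOn G Γ U)
    (hc : ∀ x ∈ U, ∀ u v w, curvature Γ x u v w = G x u w • v - G x v w • u) {x₀ : E}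
    (hx₀ : x₀ ∈ U) {ι : Type*} [Fintype ι] [DecidableEq ι] (o : ι)
    (hι : Fintype.card ι = Module.finrank ℝ E) {w : ι → E}
    (hw : ∀ i j, G x₀ (w i) (w j) = if i = j then 1 else 0) :
    ∃ V : Set E, IsOpen V ∧ x₀ ∈ V ∧ V ⊆ U ∧ ∃ Y : E → EuclideanSpace ℝ ι,
      ContDiffOn ℝ ∞ Y V ∧ (∀ i, fderiv ℝ Y x₀ (w i) = EuclideanSpace.single i 1) ∧
      ∀ x ∈ V, ∀ u v, G x u v = ∑ i, horosphericalCoeff o i (Y x) * fderiv ℝ Y x u i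
        * fderiv ℝ Y x v i := by
  obtain ⟨V, hV, hxV, hVU, a, b, ha, hb, ha0, hb0, hda0, hdb0, H⟩ :=
    h.exists_hyperboloid_immersion hc hx₀ hι hw
  have hcont : ContinuousOn (fun x ↦ a x - b o x) V := ha.continuousOn.sub (hb o).continuousOn
  -- The logarithm requires `a - b o > 0`. This holds near `x₀`, where `a - b o = 1`.
  have hV' : IsOpen (V ∩ (fun x ↦ a x - b o x) ⁻¹' Set.Ioi 0) := hcont.isOpen_inter_preimage hV
    isOpen_Ioi
  have hx₀' : x₀ ∈ V ∩ (fun x ↦ a x - b o x) ⁻¹' Set.Ioi 0 := ⟨hxV, by simp [ha0, hb0]⟩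
  have hD := fun x (hx : x ∈ V ∩ (fun x ↦ a x - b o x) ⁻¹' Set.Ioi 0) ↦
    hasFDerivAt_horosphericalMap o
      ((ha.contDiffAt (hV.mem_nhds hx.1)).differentiableAt (by simp))
      (fun i ↦ ((hb i).contDiffAt (hV.mem_nhds hx.1)).differentiableAt (by simp)) hx.2.ne'
  refine ⟨_, hV', hx₀', fun x hx ↦ hVU hx.1, horosphericalMap o a b,
    contDiffOn_horosphericalMap o (ha.mono Set.inter_subset_left)
      (fun i ↦ (hb i).mono Set.inter_subset_left) fun x hx ↦ hx.2.ne', fun j ↦ ?_,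
    fun x hx u v ↦ ?_⟩
  · obtain ⟨D, hD1, hD2⟩ := hD x₀ hx₀'
    rw [hD1.fderiv]
    ext i
    rw [hD2]
    by_cases hio : i = o
    · simp [hda0, hdb0, ha0, hb0, hio]
    · simp [hdb0, ha0, hb0, hio]
  · obtain ⟨D, hD1, hD2⟩ := hD x hx
    obtain ⟨h1, h2, h3⟩ := H x hx.1
    rw [h3, sum_horospherical o (fun i ↦ b i x) (fun i ↦ fderiv ℝ (b i) x u)
      (fun i ↦ fderiv ℝ (b i) x v) _ _ _ hx.2.ne' h1 (h2 u) (h2 v), hD1.fderiv,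
      ← Finset.add_sum_erase _ _ (Finset.mem_univ o)]
    congr 1
    · simp [hD2, horosphericalCoeff]
    · refine Finset.sum_congr rfl fun i hi ↦ ?_
      have hio := Finset.ne_of_mem_erase hi
      have hexp : Real.exp (-2 * horosphericalMap o a b x o) = (a x - b o x) ^ 2 := by
        have h4 : -2 * horosphericalMap o a b x o
            = Real.log (a x - b o x) + Real.log (a x - b o x) := by
          simp [horosphericalMap]
          ring
        rw [h4, Real.exp_add, Real.exp_log hx.2, pow_two]
      simp only [hD2, horosphericalCoeff, if_neg hio, hexp]

/-- In constant curvature `-1`, there are horospherical coordinates with prescribed orthonormal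
frame at one point. -/
theorem exists_horospherical_coordinates {ι : Type*} [Fintype ι] [DecidableEq ι]
    {G : EuclideanSpace ℝ ι → EuclideanSpace ℝ ι →L[ℝ] EuclideanSpace ℝ ι →L[ℝ] ℝ}
    {Γ : EuclideanSpace ℝ ι → EuclideanSpace ℝ ι →L[ℝ] EuclideanSpace ℝ ι →L[ℝ]
      EuclideanSpace ℝ ι} {U : Set (EuclideanSpace ℝ ι)}
    (h : IsLeviCivitaOn G Γ U)
    (hc : ∀ x ∈ U, ∀ u v w, curvature Γ x u v w = G x u w • v - G x v w • u)
    {x₀ : EuclideanSpace ℝ ι} (hx₀ : x₀ ∈ U) (o : ι) {w : ι → EuclideanSpace ℝ ι}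
    (hw : ∀ i j, G x₀ (w i) (w j) = if i = j then 1 else 0) :
    ∃ ψ : OpenPartialHomeomorph (EuclideanSpace ℝ ι) (EuclideanSpace ℝ ι),
      x₀ ∈ ψ.source ∧ ψ.source ⊆ U ∧ ContDiffOn ℝ ∞ ψ ψ.source ∧
      ContDiffOn ℝ ∞ ψ.symm ψ.target ∧
      (∀ i, fderiv ℝ ψ x₀ (w i) = EuclideanSpace.single i 1) ∧
      ∀ x ∈ ψ.source, ∀ u v, G x u v = ∑ i, horosphericalCoeff o i (ψ x) * fderiv ℝ ψ x u i
        * fderiv ℝ ψ x v i := by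
  obtain ⟨V, hV, hxV, hVU, Y, hY, hY0, hYG⟩ := h.exists_horospherical_immersion hc hx₀ o
    (by simp) hw
  have hinv : ∀ x ∈ V, ∃ D : EuclideanSpace ℝ ι ≃L[ℝ] EuclideanSpace ℝ ι,
      HasFDerivAt Y (D : EuclideanSpace ℝ ι →L[ℝ] EuclideanSpace ℝ ι) x := by
    intro x hx
    -- A vector killed by `dY` would have zero length by the formula for `G`; positivity excludes
    -- this, and injectivity suffices in equal finite dimensions.
    have hinj : Function.Injective (fderiv ℝ Y x : EuclideanSpace ℝ ι →ₗ[ℝ] EuclideanSpace ℝ ι) := by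
      rw [injective_iff_map_eq_zero]
      intro u hu
      by_contra hne
      have h1 := h.pos x (hVU hx) u hne
      have hu' : fderiv ℝ Y x u = 0 := hu
      rw [hYG x hx, hu'] at h1
      simp at h1
    refine ⟨(LinearEquiv.ofInjectiveEndo _ hinj).toContinuousLinearEquiv, ?_⟩
    exact ((hY.contDiffAt (hV.mem_nhds hx)).differentiableAt (by simp)).hasFDerivAt
  have hYat : ∀ x ∈ V, ContDiffAt ℝ ∞ Y x := fun x hx ↦ hY.contDiffAt (hV.mem_nhds hx)
  obtain ⟨D, hD⟩ := hinv x₀ hxV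
  let e := (hYat x₀ hxV).toOpenPartialHomeomorph Y hD (by simp)
  let ψ := e.restrOpen V hV
  have hψ : (ψ : EuclideanSpace ℝ ι → EuclideanSpace ℝ ι) = Y := rfl
  have hsub : ψ.source ⊆ V := fun x hx ↦ hx.2
  refine ⟨ψ, ⟨(hYat x₀ hxV).mem_toOpenPartialHomeomorph_source hD (by simp), hxV⟩,
    hsub.trans hVU, hY.mono hsub, fun z hz ↦ ?_, hY0, fun x hx ↦ hYG x (hsub hx)⟩
  have hz' := hsub (ψ.map_target hz)
  obtain ⟨D', hD'⟩ := hinv _ hz'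
  exact (ψ.contDiffAt_symm hz hD' (hYat _ hz')).contDiffWithinAt

end IsLeviCivitaOn

end LocalGeometry

/-! ### Charts of Riemannian manifolds -/

namespace RiemannianCoordinates

open LocalGeometry

section Charts

variable {n : ℕ} {M : Type*} [TopologicalSpace M] [ChartedSpace (EuclideanSpace ℝ (Fin n)) M]

theorem basisVec_apply (i j : Fin n) : (basisVec i : EuclideanSpace ℝ (Fin n)) j
    = if j = i then 1 else 0 := by
  simp [basisVec]

theorem components_smul (φ : OpenPartialHomeomorph M (EuclideanSpace ℝ (Fin n))) (p : M) (c : ℝ)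
    (u : TangentSpace (𝓡 n) p) : components φ p (c • u) = c • components φ p u :=
  map_smul _ _ _

theorem components_neg (φ : OpenPartialHomeomorph M (EuclideanSpace ℝ (Fin n))) (p : M)
    (u : TangentSpace (𝓡 n) p) : components φ p (-u) = -components φ p u :=
  map_neg _ _

theorem components_zero (φ : OpenPartialHomeomorph M (EuclideanSpace ℝ (Fin n))) (p : M) :
    components φ p (0 : TangentSpace (𝓡 n) p) = 0 :=
  map_zero _

/-- The `j`-th coordinate vector field along the `i`-th coordinate curve. -/
def coordField (y : OpenPartialHomeomorph M (EuclideanSpace ℝ (Fin n)))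
    (x : EuclideanSpace ℝ (Fin n)) (i j : Fin n) (t : ℝ) :
    TangentSpace (𝓡 n) (coordCurve y x i t) :=
  coordVec y (x + t • basisVec i) j

theorem mdifferentiable_chart {y : OpenPartialHomeomorph M (EuclideanSpace ℝ (Fin n))}
    (hy : y ∈ IsManifold.maximalAtlas (𝓡 n) ∞ M) : y.MDifferentiable (𝓡 n) (𝓡 n) :=
  ⟨(contMDiffOn_of_mem_maximalAtlas hy).mdifferentiableOn (by simp),
    (contMDiffOn_symm_of_mem_maximalAtlas hy).mdifferentiableOn (by simp)⟩

theorem mdifferentiableAt_chart_symm {y : OpenPartialHomeomorph M (EuclideanSpace ℝ (Fin n))}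
    (hy : y ∈ IsManifold.maximalAtlas (𝓡 n) ∞ M) {z : EuclideanSpace ℝ (Fin n)}
    (hz : z ∈ y.target) : MDifferentiableAt (𝓡 n) (𝓡 n) y.symm z :=
  (contMDiffAt_symm_of_mem_maximalAtlas hy hz).mdifferentiableAt (by simp)

theorem components_mfderiv_symm {y : OpenPartialHomeomorph M (EuclideanSpace ℝ (Fin n))}
    (hy : y ∈ IsManifold.maximalAtlas (𝓡 n) ∞ M) {z : EuclideanSpace ℝ (Fin n)}
    (hz : z ∈ y.target) (u : EuclideanSpace ℝ (Fin n)) :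
    components y (y.symm z) (mfderiv (𝓡 n) (𝓡 n) y.symm z u) = u :=
  congrArg (fun T ↦ T u) ((mdifferentiable_chart hy).comp_symm_deriv hz)

theorem components_coordVec {y : OpenPartialHomeomorph M (EuclideanSpace ℝ (Fin n))}
    (hy : y ∈ IsManifold.maximalAtlas (𝓡 n) ∞ M) {z : EuclideanSpace ℝ (Fin n)}
    (hz : z ∈ y.target) (i : Fin n) :
    components y (y.symm z) (coordVec y z i) = basisVec i :=
  components_mfderiv_symm hy hz _

theorem components_coordField {y : OpenPartialHomeomorph M (EuclideanSpace ℝ (Fin n))}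
    (hy : y ∈ IsManifold.maximalAtlas (𝓡 n) ∞ M) (x : EuclideanSpace ℝ (Fin n)) (i j : Fin n)
    {t : ℝ} (ht : t ∈ coordCurveDomain y x i) :
    components y (coordCurve y x i t) (coordField y x i j t) = basisVec j :=
  components_coordVec hy ht j

theorem contMDiff_line (x v : EuclideanSpace ℝ (Fin n)) :
    ContMDiff 𝓘(ℝ, ℝ) (𝓡 n) ∞ fun t : ℝ ↦ x + t • v := by
  rw [contMDiff_iff_contDiff]
  fun_prop

omit [ChartedSpace (EuclideanSpace ℝ (Fin n)) M] in
theorem isOpen_coordCurveDomain (y : OpenPartialHomeomorph M (EuclideanSpace ℝ (Fin n)))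
    (x : EuclideanSpace ℝ (Fin n)) (i : Fin n) : IsOpen (coordCurveDomain y x i) :=
  y.open_target.preimage (by fun_prop : Continuous fun t : ℝ ↦ x + t • basisVec i)

theorem contMDiffOn_coordCurve {y : OpenPartialHomeomorph M (EuclideanSpace ℝ (Fin n))}
    (hy : y ∈ IsManifold.maximalAtlas (𝓡 n) ∞ M) (x : EuclideanSpace ℝ (Fin n)) (i : Fin n) :
    ContMDiffOn 𝓘(ℝ, ℝ) (𝓡 n) ∞ (coordCurve y x i) (coordCurveDomain y x i) :=
  (contMDiffOn_symm_of_mem_maximalAtlas hy).comp (contMDiff_line x (basisVec i)).contMDiffOn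
    fun _ ht ↦ ht

theorem velocity_coordCurve {y : OpenPartialHomeomorph M (EuclideanSpace ℝ (Fin n))}
    (hy : y ∈ IsManifold.maximalAtlas (𝓡 n) ∞ M) (x : EuclideanSpace ℝ (Fin n)) (i : Fin n) {t : ℝ}
    (ht : t ∈ coordCurveDomain y x i) :
    velocity (n := n) (coordCurve y x i) t = coordField y x i i t := by
  have h1 : HasFDerivAt (fun t : ℝ ↦ x + t • basisVec i)
      (ContinuousLinearMap.toSpanSingleton ℝ (basisVec i)) t :=
    ((ContinuousLinearMap.toSpanSingleton ℝ (basisVec i)).hasFDerivAt).const_add x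
  have h2 := HasMFDerivAt.comp t (mdifferentiableAt_chart_symm hy ht).hasMFDerivAt
    h1.hasMFDerivAt
  have h3 : HasMFDerivAt 𝓘(ℝ, ℝ) (𝓡 n) (coordCurve y x i) t _ := h2
  unfold velocity
  rw [h3.mfderiv]
  change mfderiv (𝓡 n) (𝓡 n) y.symm (x + t • basisVec i) ((1 : ℝ) • basisVec i) = _
  rw [one_smul]
  rfl

variable [IsManifold (𝓡 n) ∞ M]

/-- The covariant derivative along a coordinate curve, in terms of the chart. -/
theorem hasCovDerivAlongAt_coordCurve (g : SmoothMetric n M)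
    {y : OpenPartialHomeomorph M (EuclideanSpace ℝ (Fin n))}
    (hy : y ∈ IsManifold.maximalAtlas (𝓡 n) ∞ M) (x : EuclideanSpace ℝ (Fin n)) (i : Fin n) {t : ℝ}
    (ht : t ∈ coordCurveDomain y x i) (V : ∀ s, TangentSpace (𝓡 n) (coordCurve y x i s))
    (W : TangentSpace (𝓡 n) (coordCurve y x i t)) (F : EuclideanSpace ℝ (Fin n))
    (hV : ∀ s ∈ coordCurveDomain y x i, components y (coordCurve y x i s) (V s) = F)
    (hW : ∀ k, components y (coordCurve y x i t) W k
      = ∑ j, christoffel g y k i j (x + t • basisVec i) * F j) :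
    HasCovDerivAlongAt g (coordCurve y x i) V t W := by
  have hopen := (isOpen_coordCurveDomain y x i).mem_nhds ht
  have hyt : y (coordCurve y x i t) = x + t • basisVec i := y.right_inv ht
  -- The chart `y` itself computes the covariant derivative. The components of `V` are the constant
  -- `F`, so their derivative is `0` and only the Christoffel terms survive.
  refine ⟨((contMDiffOn_coordCurve hy x i).contMDiffAt hopen).mdifferentiableAt (by simp),
    y, hy, y.map_target ht, 0, ?_, fun k ↦ ?_⟩
  · refine (hasDerivAt_const t F).congr_of_eventuallyEq ?_
    filter_upwards [hopen] with s hs using hV s hs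
  · have hvel : components y (coordCurve y x i t) (velocity (coordCurve y x i) t) = basisVec i := by
      rw [velocity_coordCurve hy x i ht]
      exact components_coordField hy x i i ht
    rw [hW, hvel, hV t ht, hyt]
    simp [basisVec]

end Charts

/-! ### Coordinate curves of horospherical coordinates -/

section Horospherical

theorem partialDeriv_horosphericalCoeff {n : ℕ} [NeZero n] (i j l : Fin n)
    (z : EuclideanSpace ℝ (Fin n)) :
    partialDeriv i (fun z ↦ Matrix.diagonal (fun j ↦ horosphericalCoeff 0 j z) j l) z
      = if j = l ∧ j ≠ 0 ∧ i = 0 then -2 * Real.exp (-2 * z 0) else 0 := by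
  unfold partialDeriv
  by_cases hjl : j = l
  · subst hjl
    simp only [Matrix.diagonal_apply_eq, horosphericalCoeff]
    by_cases hj : j = 0
    · simp [hj]
    · simp only [if_neg hj]
      have h1 : HasFDerivAt (fun z : EuclideanSpace ℝ (Fin n) ↦ z 0)
          (EuclideanSpace.proj (0 : Fin n) : EuclideanSpace ℝ (Fin n) →L[ℝ] ℝ) z :=
        (EuclideanSpace.proj (0 : Fin n) : EuclideanSpace ℝ (Fin n) →L[ℝ] ℝ).hasFDerivAt
      rw [((h1.const_mul (-2)).exp).fderiv]
      by_cases hi : i = 0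
      · simp [hi, hj, basisVec]
        ring
      · simp [hi, basisVec, Ne.symm hi]
  · simp [hjl]

variable {n : ℕ} [NeZero n] {M : Type*} [TopologicalSpace M]
  [ChartedSpace (EuclideanSpace ℝ (Fin n)) M] [IsManifold (𝓡 n) ∞ M]

/-- The chart `y` consists of horospherical coordinates. -/
def IsHorospherical (g : SmoothMetric n M)
    (y : OpenPartialHomeomorph M (EuclideanSpace ℝ (Fin n))) : Prop :=
  ∀ z ∈ y.target, metricMatrix g y z = Matrix.diagonal fun i ↦ horosphericalCoeff 0 i z

variable {g : SmoothMetric n M} {y : OpenPartialHomeomorph M (EuclideanSpace ℝ (Fin n))}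

/-- The metric is diagonal, and only the entries with index different from `0` vary, only in the
direction `0`. The nonzero symbols are thus `Γᵏ₀ₖ = Γᵏₖ₀ = -1` and `Γ⁰ᵢᵢ = e^{-2 z₀}` for `k, i ≠
0`. -/
theorem christoffel_horospherical (h : IsHorospherical g y) {z : EuclideanSpace ℝ (Fin n)}
    (hz : z ∈ y.target) (k i j : Fin n) :
    christoffel g y k i j z = (1 / 2) * ((horosphericalCoeff 0 k z)⁻¹ *
      ((if j = k ∧ j ≠ 0 ∧ i = 0 then -2 * Real.exp (-2 * z 0) else 0)
      + (if i = k ∧ i ≠ 0 ∧ j = 0 then -2 * Real.exp (-2 * z 0) else 0)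
      - (if i = j ∧ i ≠ 0 ∧ k = 0 then -2 * Real.exp (-2 * z 0) else 0))) := by
  have hpd : ∀ i j l, partialDeriv i (fun z ↦ metricMatrix g y z j l) z
      = if j = l ∧ j ≠ 0 ∧ i = 0 then -2 * Real.exp (-2 * z 0) else 0 := by
    intro i j l
    rw [← partialDeriv_horosphericalCoeff]
    unfold partialDeriv
    have : (fun z ↦ metricMatrix g y z j l) =ᶠ[nhds z]
        fun z ↦ Matrix.diagonal (fun j ↦ horosphericalCoeff 0 j z) j l := by
      filter_upwards [y.open_target.mem_nhds hz] with w hw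
      rw [h w hw]
    rw [this.fderiv_eq]
  have hinv : (metricMatrix g y z)⁻¹ = Matrix.diagonal fun i ↦ (horosphericalCoeff 0 i z)⁻¹ := by
    refine Matrix.inv_eq_right_inv ?_
    rw [h z hz, Matrix.diagonal_mul_diagonal, ← Matrix.diagonal_one]
    congr 1
    funext i
    exact mul_inv_cancel₀ (horosphericalCoeff_pos 0 i z).ne'
  unfold christoffel
  rw [hinv]
  simp only [hpd, Matrix.diagonal_apply, ite_mul, zero_mul, Finset.sum_ite_eq, Finset.mem_univ,
    if_true]

theorem isGeodesicOn_coordCurve (hy : y ∈ IsManifold.maximalAtlas (𝓡 n) ∞ M)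
    (h : IsHorospherical g y) (x : EuclideanSpace ℝ (Fin n)) :
    IsGeodesicOn g (coordCurve y x 0) (coordCurveDomain y x 0) := by
  refine ⟨contMDiffOn_coordCurve hy x 0, fun t ht ↦ ?_⟩
  refine hasCovDerivAlongAt_coordCurve g hy x 0 ht _ _ (basisVec 0) (fun s hs ↦ ?_) fun k ↦ ?_
  · rw [velocity_coordCurve hy x 0 hs, components_coordField hy x 0 0 hs]
  · simp [components_zero, basisVec_apply, christoffel_horospherical h ht]

theorem inner_coordField (h : IsHorospherical g y) (x : EuclideanSpace ℝ (Fin n)) (i : Fin n)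
    {t : ℝ} (ht : t ∈ coordCurveDomain y x i) (j k : Fin n) :
    g.inner (coordCurve y x i t) (coordField y x i j t) (coordField y x i k t)
      = if j = k then horosphericalCoeff 0 j (x + t • basisVec i) else 0 := by
  have := congrFun (congrFun (h _ ht) j) k
  rw [Matrix.diagonal_apply] at this
  exact this

theorem speed_coordCurve (hy : y ∈ IsManifold.maximalAtlas (𝓡 n) ∞ M)
    (h : IsHorospherical g y) (x : EuclideanSpace ℝ (Fin n)) {i : Fin n} (hi : i ≠ 0) {t : ℝ}
    (ht : t ∈ coordCurveDomain y x i) : speed g (coordCurve y x i) t = Real.exp (-x 0) := by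
  rw [speed, velocity_coordCurve hy x i ht, inner_coordField h x i ht, if_pos rfl,
    horosphericalCoeff, if_neg hi, show -2 * (x + t • basisVec i) 0 = -x 0 + -x 0 by
      simp [basisVec_apply, hi.symm]; ring, Real.exp_add, Real.sqrt_mul_self (Real.exp_pos _).le]

/-- Along the curve `z₀` is constant, so `T = e^{x₀} ∂ᵢ` and `N = ∂₀` have constant components and
their covariant derivatives are read off from the Christoffel symbols: `∇_{∂ᵢ} T = e^{-x₀} ∂₀` is
speed times `N`, and `∇_{∂ᵢ} N = -∂ᵢ` is minus speed times `T`. -/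
theorem isHorocycleOn_coordCurve (hy : y ∈ IsManifold.maximalAtlas (𝓡 n) ∞ M)
    (h : IsHorospherical g y) (x : EuclideanSpace ℝ (Fin n)) {i : Fin n} (hi : i ≠ 0) :
    IsHorocycleOn g (coordCurve y x i) (coordCurveDomain y x i) := by
  have hz0 : ∀ t : ℝ, (x + t • basisVec i) 0 = x 0 := fun t ↦ by simp [basisVec_apply, hi.symm]
  have hspeed := fun t (ht : t ∈ coordCurveDomain y x i) ↦ speed_coordCurve hy h x hi ht
  have hT : ∀ t ∈ coordCurveDomain y x i, unitTangent g (coordCurve y x i) t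
      = Real.exp (x 0) • coordField y x i i t := by
    intro t ht
    rw [unitTangent, velocity_coordCurve hy x i ht, hspeed t ht, Real.exp_neg, inv_inv]
  refine ⟨contMDiffOn_coordCurve hy x i, fun t ht h0 ↦ ?_,
    fun t ↦ coordField y x i 0 t, fun t ht ↦ ⟨?_, ?_, ?_, ?_⟩⟩
  · have := hspeed t ht
    rw [speed, h0] at this
    simp only [map_zero, Real.sqrt_zero] at this
    exact (Real.exp_pos _).ne this
  · rw [inner_coordField h x i ht]
    simp [horosphericalCoeff]
  · rw [hT t ht, map_smul, inner_coordField h x i ht]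
    simp [hi.symm]
  · refine hasCovDerivAlongAt_coordCurve g hy x i ht _ _ (Real.exp (x 0) • basisVec i)
      (fun s hs ↦ ?_) fun k ↦ ?_
    · rw [hT s hs, components_smul, components_coordField hy x i i hs]
    · rw [components_smul, components_coordField hy x i 0 ht, hspeed t ht]
      by_cases hk : k = 0
      · have he : Real.exp (-x 0) = Real.exp (-(2 * x 0)) * Real.exp (x 0) := by
          rw [← Real.exp_add]
          ring_nf
        simp [basisVec_apply, christoffel_horospherical h ht, hz0, hi, hk, horosphericalCoeff, he]
      · simp [basisVec_apply, christoffel_horospherical h ht, hz0, hi, hk, horosphericalCoeff]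
  · refine hasCovDerivAlongAt_coordCurve g hy x i ht _ _ (basisVec 0) (fun s hs ↦ ?_) fun k ↦ ?_
    · exact components_coordField hy x i 0 hs
    · rw [hT t ht, hspeed t ht, smul_smul, ← Real.exp_add, neg_add_cancel, Real.exp_zero,
        one_smul, components_neg, components_coordField hy x i i ht]
      by_cases hk : k = i
      · simp [basisVec_apply, christoffel_horospherical h ht, hz0, hi, hk, horosphericalCoeff]
        field_simp
      · simp [basisVec_apply, christoffel_horospherical h ht, hz0, hi, hk, Ne.symm hk,
          horosphericalCoeff]

end Horospherical

end RiemannianCoordinates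

/-! ### Bilinear maps and matrices with smooth coefficients -/

namespace RiemannianCoordinates

open LocalGeometry

section Coefficients

variable {n : ℕ} {F : Type*} [NormedAddCommGroup F] [NormedSpace ℝ F]

/-- The bilinear map with given values on pairs of basis vectors. -/
def bilinearOfCoeff (c : Fin n → Fin n → F) :
    EuclideanSpace ℝ (Fin n) →L[ℝ] EuclideanSpace ℝ (Fin n) →L[ℝ] F :=
  ∑ i, ∑ j, (EuclideanSpace.proj i : EuclideanSpace ℝ (Fin n) →L[ℝ] ℝ).smulRight
    ((EuclideanSpace.proj j : EuclideanSpace ℝ (Fin n) →L[ℝ] ℝ).smulRight (c i j))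

theorem bilinearOfCoeff_apply (c : Fin n → Fin n → F) (u v : EuclideanSpace ℝ (Fin n)) :
    bilinearOfCoeff c u v = ∑ i, ∑ j, (u i * v j) • c i j := by
  simp [bilinearOfCoeff, mul_smul]

theorem bilinearOfCoeff_basis (c : Fin n → Fin n → F) (i j : Fin n) :
    bilinearOfCoeff c (basisVec i) (basisVec j) = c i j := by
  simp [bilinearOfCoeff_apply, basisVec_apply]

theorem contDiffOn_bilinearOfCoeff {E : Type*} [NormedAddCommGroup E] [NormedSpace ℝ E]
    {c : E → Fin n → Fin n → F} {U : Set E} (hc : ∀ i j, ContDiffOn ℝ ∞ (fun x ↦ c x i j) U) :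
    ContDiffOn ℝ ∞ (fun x ↦ bilinearOfCoeff (c x)) U :=
  ContDiffOn.sum fun i _ ↦ ContDiffOn.sum fun j _ ↦
    contDiffOn_const.smulRight (contDiffOn_const.smulRight (hc i j))

theorem fderiv_bilinearOfCoeff {E : Type*} [NormedAddCommGroup E] [NormedSpace ℝ E]
    {c : E → Fin n → Fin n → F} {U : Set E} (hU : IsOpen U)
    (hc : ∀ i j, ContDiffOn ℝ ∞ (fun x ↦ c x i j) U) {x : E} (hx : x ∈ U) (u : E) (i j : Fin n) :
    fderiv ℝ (fun x ↦ bilinearOfCoeff (c x)) x u (basisVec i) (basisVec j)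
      = fderiv ℝ (fun x ↦ c x i j) x u := by
  have e0 : HasFDerivAt (fun x ↦ bilinearOfCoeff (c x)) _ x :=
    (((contDiffOn_bilinearOfCoeff hc).contDiffAt (hU.mem_nhds hx)).differentiableAt
      (by simp)).hasFDerivAt
  have e1 := (e0.clm_apply (hasFDerivAt_const (basisVec i : EuclideanSpace ℝ (Fin n)) x)).clm_apply
    (hasFDerivAt_const (basisVec j : EuclideanSpace ℝ (Fin n)) x)
  simp only [bilinearOfCoeff_basis] at e1
  rw [e1.fderiv]
  simp

/-- Unbundled linearity allows tensor identities to be checked on basis vectors one slot at a time.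
-/
theorem eq_of_eq_basis {f g : EuclideanSpace ℝ (Fin n) → F} (hf : IsLinearMap ℝ f)
    (hg : IsLinearMap ℝ g) (h : ∀ i, f (basisVec i) = g (basisVec i))
    (u : EuclideanSpace ℝ (Fin n)) : f u = g u := by
  have : hf.mk' f = hg.mk' g := by
    refine (EuclideanSpace.basisFun (Fin n) ℝ).toBasis.ext fun i ↦ ?_
    simpa [basisVec] using h i
  exact congrArg (fun T : EuclideanSpace ℝ (Fin n) →ₗ[ℝ] F ↦ T u) this

theorem eq_sum_basisVec (u : EuclideanSpace ℝ (Fin n)) : u = ∑ i, u i • basisVec i := by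
  ext j
  simp [basisVec_apply]

theorem eq_sum_of_isLinearMap {f : EuclideanSpace ℝ (Fin n) → F} (hf : IsLinearMap ℝ f)
    (u : EuclideanSpace ℝ (Fin n)) : f u = ∑ i, u i • f (basisVec i) := by
  conv_lhs => rw [eq_sum_basisVec u]
  exact (map_sum (hf.mk' f) _ _).trans (Finset.sum_congr rfl fun i _ ↦ map_smul (hf.mk' f) _ _)

theorem contDiffOn_det {E : Type*} [NormedAddCommGroup E] [NormedSpace ℝ E] {U : Set E}
    {A : E → Matrix (Fin n) (Fin n) ℝ} (hA : ∀ i j, ContDiffOn ℝ ∞ (fun x ↦ A x i j) U) :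
    ContDiffOn ℝ ∞ (fun x ↦ (A x).det) U := by
  simp only [Matrix.det_apply']
  exact ContDiffOn.sum fun σ _ ↦ contDiffOn_const.mul (contDiffOn_prod fun i _ ↦ hA _ _)

theorem contDiffOn_matrix_inv {E : Type*} [NormedAddCommGroup E] [NormedSpace ℝ E] {U : Set E}
    {A : E → Matrix (Fin n) (Fin n) ℝ} (hA : ∀ i j, ContDiffOn ℝ ∞ (fun x ↦ A x i j) U)
    (hdet : ∀ x ∈ U, (A x).det ≠ 0) (i j : Fin n) :
    ContDiffOn ℝ ∞ (fun x ↦ (A x)⁻¹ i j) U := by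
  have h1 : ContDiffOn ℝ ∞ (fun x ↦ (A x).adjugate i j) U := by
    simp only [Matrix.adjugate_apply]
    refine contDiffOn_det fun k l ↦ ?_
    by_cases hk : k = j
    · simp only [hk, Matrix.updateRow_self]
      exact contDiffOn_const
    · simp only [Matrix.updateRow_ne hk]
      exact hA k l
  simp only [Matrix.inv_def, Matrix.smul_apply, Ring.inverse_eq_inv', smul_eq_mul]
  exact ((contDiffOn_det hA).inv hdet).mul h1

end Coefficients

/-! ### Metric, Levi-Civita connection and curvature in a chart -/

section Metric

variable {n : ℕ} {M : Type*} [TopologicalSpace M] [ChartedSpace (EuclideanSpace ℝ (Fin n)) M]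
  [IsManifold (𝓡 n) ∞ M]

/-- The coordinate field is the image of a constant section under the tangent map of `φ.symm`. -/
theorem contMDiffOn_coordVec {φ : OpenPartialHomeomorph M (EuclideanSpace ℝ (Fin n))}
    (hφ : φ ∈ IsManifold.maximalAtlas (𝓡 n) ∞ M) (i : Fin n) :
    ContMDiffOn (𝓡 n) (𝓡 n).tangent ∞
      (fun z ↦ (⟨φ.symm z, coordVec φ z i⟩ : TangentBundle (𝓡 n) M)) φ.target := by
  have : IsManifold (𝓡 n) 1 M := IsManifold.of_le (n := ∞) (by simp)
  have h1 : ContMDiffOn (𝓡 n) (𝓡 n).tangent ∞ (fun z : EuclideanSpace ℝ (Fin n) ↦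
      (⟨z, basisVec i⟩ : TangentBundle (𝓡 n) (EuclideanSpace ℝ (Fin n)))) φ.target :=
    contMDiffOn_vectorSpace_iff_contDiffOn.2 contDiffOn_const
  have h2 := ((contMDiffOn_symm_of_mem_maximalAtlas hφ).contMDiffOn_tangentMapWithin (m := ∞)
    (by simp) φ.open_target.uniqueMDiffOn).comp h1 fun z hz ↦ hz
  refine h2.congr fun z hz ↦ ?_
  simp only [Function.comp, tangentMapWithin, coordVec]
  rw [mfderivWithin_of_isOpen φ.open_target hz]

theorem contDiffOn_metricMatrix (g : SmoothMetric n M)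
    {φ : OpenPartialHomeomorph M (EuclideanSpace ℝ (Fin n))}
    (hφ : φ ∈ IsManifold.maximalAtlas (𝓡 n) ∞ M) (i j : Fin n) :
    ContDiffOn ℝ ∞ (fun z ↦ metricMatrix g φ z i j) φ.target := by
  rw [← contMDiffOn_iff_contDiffOn]
  intro z hz
  have : ContMDiffWithinAt (𝓡 n) ((𝓡 n).prod 𝓘(ℝ)) ∞
      (fun z ↦ Bundle.TotalSpace.mk' ℝ (E := Bundle.Trivial M ℝ) (φ.symm z)
        (g.inner (φ.symm z) (coordVec φ z i) (coordVec φ z j))) φ.target z := by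
    apply ContMDiffWithinAt.clm_bundle_apply₂ (F₁ := EuclideanSpace ℝ (Fin n))
      (F₂ := EuclideanSpace ℝ (Fin n))
    · exact ContMDiffAt.comp_contMDiffWithinAt z g.contMDiff.contMDiffAt
        (contMDiffOn_symm_of_mem_maximalAtlas hφ z hz)
    · exact contMDiffOn_coordVec hφ i z hz
    · exact contMDiffOn_coordVec hφ j z hz
  simp only [Bundle.contMDiffWithinAt_totalSpace] at this
  exact this.2

/-- The metric `g` in the chart `φ`. -/
def metricForm (g : SmoothMetric n M) (φ : OpenPartialHomeomorph M (EuclideanSpace ℝ (Fin n)))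
    (x : EuclideanSpace ℝ (Fin n)) :
    EuclideanSpace ℝ (Fin n) →L[ℝ] EuclideanSpace ℝ (Fin n) →L[ℝ] ℝ :=
  bilinearOfCoeff fun i j ↦ metricMatrix g φ x i j

/-- The Christoffel symbols of `g` in the chart `φ` as a bilinear map. -/
def connectionForm (g : SmoothMetric n M) (φ : OpenPartialHomeomorph M (EuclideanSpace ℝ (Fin n)))
    (x : EuclideanSpace ℝ (Fin n)) :
    EuclideanSpace ℝ (Fin n) →L[ℝ] EuclideanSpace ℝ (Fin n) →L[ℝ] EuclideanSpace ℝ (Fin n) :=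
  bilinearOfCoeff fun i j ↦ WithLp.toLp 2 fun k ↦ christoffel g φ k i j x

variable (g : SmoothMetric n M) {φ : OpenPartialHomeomorph M (EuclideanSpace ℝ (Fin n))}

theorem metricForm_apply (x u v : EuclideanSpace ℝ (Fin n)) :
    metricForm g φ x u v = g.inner (φ.symm x) (mfderiv (𝓡 n) (𝓡 n) φ.symm x u)
      (mfderiv (𝓡 n) (𝓡 n) φ.symm x v) := by
  let D : EuclideanSpace ℝ (Fin n) →L[ℝ] TangentSpace (𝓡 n) (φ.symm x) :=
    mfderiv (𝓡 n) (𝓡 n) φ.symm x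
  change metricForm g φ x u v = g.inner (φ.symm x) (D u) (D v)
  refine eq_of_eq_basis (f := fun u ↦ metricForm g φ x u v)
    (g := fun u ↦ g.inner (φ.symm x) (D u) (D v)) ⟨by simp, by simp⟩ ⟨by simp, by simp⟩
    (fun i ↦ ?_) u
  refine eq_of_eq_basis (f := fun v ↦ metricForm g φ x (basisVec i) v)
    (g := fun v ↦ g.inner (φ.symm x) (D (basisVec i)) (D v)) ⟨by simp, by simp⟩
    ⟨by simp, by simp⟩ (fun j ↦ ?_) v
  exact bilinearOfCoeff_basis _ i j

theorem metricMatrix_symm (x : EuclideanSpace ℝ (Fin n)) (i j : Fin n) :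
    metricMatrix g φ x i j = metricMatrix g φ x j i :=
  g.symm _ _ _

theorem metricForm_symm (x u v : EuclideanSpace ℝ (Fin n)) :
    metricForm g φ x u v = metricForm g φ x v u := by
  rw [metricForm_apply, metricForm_apply, g.symm]

theorem metricForm_pos (hφ : φ ∈ IsManifold.maximalAtlas (𝓡 n) ∞ M)
    {x : EuclideanSpace ℝ (Fin n)} (hx : x ∈ φ.target) {u : EuclideanSpace ℝ (Fin n)}
    (hu : u ≠ 0) : 0 < metricForm g φ x u u := by
  rw [metricForm_apply]
  refine g.pos _ _ fun h ↦ hu ?_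
  rw [← components_mfderiv_symm hφ hx u, h]
  exact map_zero _

theorem metricForm_eq_mulVec (x u : EuclideanSpace ℝ (Fin n)) (j : Fin n) :
    metricForm g φ x (basisVec j) u = (metricMatrix g φ x).mulVec u j := by
  simp [metricForm, bilinearOfCoeff_apply, basisVec_apply, Matrix.mulVec, dotProduct, mul_comm]

/-- A vector in the kernel of the matrix would be orthogonal to everything, itself included, against
positivity. -/
theorem det_metricMatrix_ne_zero (hφ : φ ∈ IsManifold.maximalAtlas (𝓡 n) ∞ M)
    {x : EuclideanSpace ℝ (Fin n)} (hx : x ∈ φ.target) : (metricMatrix g φ x).det ≠ 0 := by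
  intro h0
  obtain ⟨v, hv, hv0⟩ := Matrix.exists_mulVec_eq_zero_iff.2 h0
  have hne : (WithLp.toLp 2 v : EuclideanSpace ℝ (Fin n)) ≠ 0 := by
    simpa using hv
  have h1 := metricForm_pos g hφ hx hne
  have h2 : ∀ u, metricForm g φ x u (WithLp.toLp 2 v) = 0 := by
    refine eq_of_eq_basis (g := fun _ ↦ 0) ⟨by simp, by simp⟩ ⟨by simp, by simp⟩ fun j ↦ ?_
    rw [metricForm_eq_mulVec, hv0]
    rfl
  exact h1.ne' (h2 _)

theorem contDiffOn_partialDeriv {U : Set (EuclideanSpace ℝ (Fin n))} (hU : IsOpen U)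
    {f : EuclideanSpace ℝ (Fin n) → ℝ} (hf : ContDiffOn ℝ ∞ f U) (i : Fin n) :
    ContDiffOn ℝ ∞ (partialDeriv i f) U :=
  (hf.fderiv_of_isOpen hU (by simp)).clm_apply contDiffOn_const

theorem contDiffOn_christoffel (hφ : φ ∈ IsManifold.maximalAtlas (𝓡 n) ∞ M) (k i j : Fin n) :
    ContDiffOn ℝ ∞ (christoffel g φ k i j) φ.target := by
  have hM := contDiffOn_metricMatrix g hφ
  have hd := fun i j l ↦ contDiffOn_partialDeriv φ.open_target (hM j l) i
  exact contDiffOn_const.mul <| ContDiffOn.sum fun l _ ↦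
    (contDiffOn_matrix_inv hM (fun x hx ↦ det_metricMatrix_ne_zero g hφ hx) k l).mul
      (((hd i j l).add (hd j i l)).sub (hd l i j))

theorem christoffel_symm (k i j : Fin n) (x : EuclideanSpace ℝ (Fin n)) :
    christoffel g φ k i j x = christoffel g φ k j i x := by
  unfold christoffel
  congr 1
  refine Finset.sum_congr rfl fun l _ ↦ ?_
  simp only [metricMatrix_symm g _ i j]
  ring

theorem connectionForm_basis (x : EuclideanSpace ℝ (Fin n)) (i j : Fin n) :
    connectionForm g φ x (basisVec i) (basisVec j)
      = WithLp.toLp 2 fun k ↦ christoffel g φ k i j x :=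
  bilinearOfCoeff_basis _ i j

theorem connectionForm_symm (x u v : EuclideanSpace ℝ (Fin n)) :
    connectionForm g φ x u v = connectionForm g φ x v u := by
  simp only [connectionForm, bilinearOfCoeff_apply]
  rw [Finset.sum_comm]
  refine Finset.sum_congr rfl fun i _ ↦ Finset.sum_congr rfl fun j _ ↦ ?_
  rw [mul_comm]
  simp only [christoffel_symm g _ j i]

theorem contDiffOn_metricForm (hφ : φ ∈ IsManifold.maximalAtlas (𝓡 n) ∞ M) :
    ContDiffOn ℝ ∞ (metricForm g φ) φ.target :=
  contDiffOn_bilinearOfCoeff fun i j ↦ contDiffOn_metricMatrix g hφ i j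

theorem contDiffOn_christoffel_vector (hφ : φ ∈ IsManifold.maximalAtlas (𝓡 n) ∞ M)
    (i j : Fin n) : ContDiffOn ℝ ∞ (fun x ↦ (WithLp.toLp 2 fun k ↦ christoffel g φ k i j x :
      EuclideanSpace ℝ (Fin n))) φ.target :=
  contDiffOn_euclidean.2 fun k ↦ contDiffOn_christoffel g hφ k i j

theorem contDiffOn_connectionForm (hφ : φ ∈ IsManifold.maximalAtlas (𝓡 n) ∞ M) :
    ContDiffOn ℝ ∞ (connectionForm g φ) φ.target :=
  contDiffOn_bilinearOfCoeff fun i j ↦ contDiffOn_christoffel_vector g hφ i j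

/-- Lowering the upper index cancels the inverse matrix in the Christoffel symbols and leaves
Koszul's formula. -/
theorem metricForm_connectionForm (hφ : φ ∈ IsManifold.maximalAtlas (𝓡 n) ∞ M)
    {x : EuclideanSpace ℝ (Fin n)} (hx : x ∈ φ.target) (i j l : Fin n) :
    metricForm g φ x (basisVec l) (connectionForm g φ x (basisVec i) (basisVec j))
      = (1 / 2) * (partialDeriv i (fun z ↦ metricMatrix g φ z j l) x
        + partialDeriv j (fun z ↦ metricMatrix g φ z i l) x
        - partialDeriv l (fun z ↦ metricMatrix g φ z i j) x) := by
  rw [metricForm_eq_mulVec, connectionForm_basis]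
  have h1 : (fun k ↦ christoffel g φ k i j x) = (1 / 2 : ℝ) • (metricMatrix g φ x)⁻¹.mulVec
      fun l ↦ partialDeriv i (fun z ↦ metricMatrix g φ z j l) x
        + partialDeriv j (fun z ↦ metricMatrix g φ z i l) x
        - partialDeriv l (fun z ↦ metricMatrix g φ z i j) x := rfl
  change (metricMatrix g φ x).mulVec (fun k ↦ christoffel g φ k i j x) l = _
  rw [h1, Matrix.mulVec_smul, Matrix.mulVec_mulVec,
    Matrix.mul_nonsing_inv _ (det_metricMatrix_ne_zero g hφ hx).isUnit, Matrix.one_mulVec]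
  rfl

theorem isLeviCivitaOn_chart (hφ : φ ∈ IsManifold.maximalAtlas (𝓡 n) ∞ M) :
    IsLeviCivitaOn (metricForm g φ) (connectionForm g φ) φ.target where
  isOpen := φ.open_target
  contDiffOn_metric := contDiffOn_metricForm g hφ
  contDiffOn_connection := contDiffOn_connectionForm g hφ
  symm x _ u v := metricForm_symm g x u v
  pos _ hx _ hu := metricForm_pos g hφ hx hu
  torsion x _ u v := connectionForm_symm g x u v
  compat x hx u v w := by
    refine eq_of_eq_basis (f := fun u ↦ fderiv ℝ (metricForm g φ) x u v w)
      (g := fun u ↦ metricForm g φ x (connectionForm g φ x u v) w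
        + metricForm g φ x v (connectionForm g φ x u w))
      ⟨by simp, by simp⟩ ⟨by intros; simp; ring, by intros; simp; ring⟩ (fun i ↦ ?_) u
    refine eq_of_eq_basis (f := fun v ↦ fderiv ℝ (metricForm g φ) x (basisVec i) v w)
      (g := fun v ↦ metricForm g φ x (connectionForm g φ x (basisVec i) v) w
        + metricForm g φ x v (connectionForm g φ x (basisVec i) w))
      ⟨by simp, by simp⟩ ⟨by intros; simp; ring, by intros; simp; ring⟩ (fun j ↦ ?_) v
    refine eq_of_eq_basis (f := fun w ↦ fderiv ℝ (metricForm g φ) x (basisVec i) (basisVec j) w)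
      (g := fun w ↦ metricForm g φ x (connectionForm g φ x (basisVec i) (basisVec j)) w
        + metricForm g φ x (basisVec j) (connectionForm g φ x (basisVec i) w))
      ⟨by simp, by simp⟩ ⟨by intros; simp; ring, by intros; simp; ring⟩ (fun k ↦ ?_) w
    have h1 : fderiv ℝ (metricForm g φ) x (basisVec i) (basisVec j) (basisVec k)
        = partialDeriv i (fun z ↦ metricMatrix g φ z j k) x :=
      fderiv_bilinearOfCoeff φ.open_target (fun i j ↦ contDiffOn_metricMatrix g hφ i j) hx _ _ _
    simp only [h1]
    -- The two Koszul expressions add up to `∂ᵢ gⱼₖ`; their other terms cancel in pairs.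
    rw [metricForm_symm g x _ (basisVec k), metricForm_connectionForm g hφ hx,
      metricForm_connectionForm g hφ hx]
    simp only [metricMatrix_symm g _ k j]
    ring

theorem curvature_basis (hφ : φ ∈ IsManifold.maximalAtlas (𝓡 n) ∞ M)
    {x : EuclideanSpace ℝ (Fin n)} (hx : x ∈ φ.target) (i j k l : Fin n) :
    curvature (connectionForm g φ) x (basisVec i) (basisVec j) (basisVec k) l
      = curvatureTensor g φ l k i j x := by
  have h1 : ∀ i j k l, fderiv ℝ (connectionForm g φ) x (basisVec i) (basisVec j) (basisVec k) l
      = partialDeriv i (christoffel g φ l j k) x := by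
    intro i j k l
    have := fderiv_bilinearOfCoeff φ.open_target
      (fun i j ↦ contDiffOn_christoffel_vector g hφ i j) hx (basisVec i) j k
    unfold connectionForm
    rw [this]
    have h2 := ((contDiffOn_christoffel_vector g hφ j k).contDiffAt
      (φ.open_target.mem_nhds hx)).differentiableAt (by simp)
    have h3 := ((EuclideanSpace.proj l : EuclideanSpace ℝ (Fin n) →L[ℝ] ℝ).hasFDerivAt).comp x
      h2.hasFDerivAt
    have h4 : HasFDerivAt (christoffel g φ l j k) _ x := h3
    rw [partialDeriv, h4.fderiv]
    rfl
  have h2 : ∀ i j k l, connectionForm g φ x (basisVec i)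
      (connectionForm g φ x (basisVec j) (basisVec k)) l
        = ∑ m, christoffel g φ l i m x * christoffel g φ m j k x := by
    intro i j k l
    rw [connectionForm_basis, eq_sum_basisVec (WithLp.toLp 2 _), map_sum]
    simp [connectionForm_basis, mul_comm]
  simp [curvature, curvatureTensor, h1, h2, Finset.sum_sub_distrib]
  ring

theorem metricForm_curvature (hφ : φ ∈ IsManifold.maximalAtlas (𝓡 n) ∞ M)
    {x : EuclideanSpace ℝ (Fin n)} (hx : x ∈ φ.target) (a b c d : EuclideanSpace ℝ (Fin n)) :
    metricForm g φ x (curvature (connectionForm g φ) x a b c) d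
      = ∑ i, ∑ j, ∑ k, ∑ l, ∑ m, metricMatrix g φ x l m * curvatureTensor g φ l k i j x
        * a i * b j * c k * d m := by
  have e1 : ∀ b c, IsLinearMap ℝ fun a ↦ metricForm g φ x
      (curvature (connectionForm g φ) x a b c) d := fun b c ↦
    ⟨by intros; simp [curvature]; ring, by intros; simp [curvature]; ring⟩
  have e2 : ∀ a c, IsLinearMap ℝ fun b ↦ metricForm g φ x
      (curvature (connectionForm g φ) x a b c) d := fun a c ↦
    ⟨by intros; simp [curvature]; ring, by intros; simp [curvature]; ring⟩
  have e3 : ∀ a b, IsLinearMap ℝ fun c ↦ metricForm g φ x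
      (curvature (connectionForm g φ) x a b c) d := fun a b ↦
    ⟨by intros; simp [curvature]; ring, by intros; simp [curvature]; ring⟩
  rw [eq_sum_of_isLinearMap (e1 b c)]
  refine Finset.sum_congr rfl fun i _ ↦ ?_
  rw [eq_sum_of_isLinearMap (e2 _ c), Finset.smul_sum]
  refine Finset.sum_congr rfl fun j _ ↦ ?_
  rw [eq_sum_of_isLinearMap (e3 _ _), Finset.smul_sum, Finset.smul_sum]
  refine Finset.sum_congr rfl fun k _ ↦ ?_
  simp only [metricForm, bilinearOfCoeff_apply, curvature_basis g hφ hx, Finset.smul_sum]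
  refine Finset.sum_congr rfl fun l _ ↦ Finset.sum_congr rfl fun m _ ↦ ?_
  simp only [smul_eq_mul]
  ring

/-- The curvature hypothesis concerns tangent vectors of `M`; it is applied to the images of `u` and
`w` under the differential of `φ.symm`, whose components are `u` and `w` again. -/
theorem sectional_eq (hφ : φ ∈ IsManifold.maximalAtlas (𝓡 n) ∞ M)
    (hg : HasConstantSectionalCurvature g (-1)) {x : EuclideanSpace ℝ (Fin n)} (hx : x ∈ φ.target)
    (u w : EuclideanSpace ℝ (Fin n)) (hl : LinearIndependent ℝ ![u, w]) :
    metricForm g φ x (curvature (connectionForm g φ) x u w w) u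
      / (metricForm g φ x u u * metricForm g φ x w w - metricForm g φ x u w ^ 2) = -1 := by
  let D : EuclideanSpace ℝ (Fin n) →L[ℝ] TangentSpace (𝓡 n) (φ.symm x) :=
    mfderiv (𝓡 n) (𝓡 n) φ.symm x
  have hD : ∀ v, components φ (φ.symm x) (D v) = v := components_mfderiv_symm hφ hx
  have hl' : LinearIndependent ℝ ![D u, D w] := by
    rw [LinearIndependent.pair_iff] at hl ⊢
    intro s t hst
    refine hl s t ?_
    rw [← map_smul, ← map_smul, ← map_add] at hst
    rw [← hD (s • u + t • w), hst, components_zero]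
  have := hg φ hφ (φ.symm x) (φ.map_target hx) (D u) (D w) hl'
  rw [sectionalCurvature, hD, hD, φ.right_inv hx, ← metricForm_curvature g hφ hx] at this
  rw [metricForm_apply g x u u, metricForm_apply g x w w, metricForm_apply g x u w]
  exact this

theorem curvature_connectionForm (hφ : φ ∈ IsManifold.maximalAtlas (𝓡 n) ∞ M)
    (hg : HasConstantSectionalCurvature g (-1)) {x : EuclideanSpace ℝ (Fin n)} (hx : x ∈ φ.target)
    (u v w : EuclideanSpace ℝ (Fin n)) : curvature (connectionForm g φ) x u v w
      = metricForm g φ x u w • v - metricForm g φ x v w • u :=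
  (isLeviCivitaOn_chart g hφ).curvature_eq hx (sectional_eq g hφ hg hx) u v w

end Metric

/-! ### Composition of a chart with a local diffeomorphism -/

section ChangeOfCoordinates

variable {n : ℕ} {M : Type*} [TopologicalSpace M] [ChartedSpace (EuclideanSpace ℝ (Fin n)) M]
  [IsManifold (𝓡 n) ∞ M] {φ : OpenPartialHomeomorph M (EuclideanSpace ℝ (Fin n))}
  {ψ : OpenPartialHomeomorph (EuclideanSpace ℝ (Fin n)) (EuclideanSpace ℝ (Fin n))}

theorem trans_mem_maximalAtlas (hφ : φ ∈ IsManifold.maximalAtlas (𝓡 n) ∞ M)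
    (hψ : ContDiffOn ℝ ∞ ψ ψ.source) (hψ' : ContDiffOn ℝ ∞ ψ.symm ψ.target) :
    φ.trans ψ ∈ IsManifold.maximalAtlas (𝓡 n) ∞ M := by
  refine (φ.trans ψ).mem_maximalAtlas_of_contMDiffOn ?_ ?_
  · exact hψ.contMDiffOn.comp ((contMDiffOn_of_mem_maximalAtlas hφ).mono fun p hp ↦ hp.1)
      fun p hp ↦ hp.2
  · exact (contMDiffOn_symm_of_mem_maximalAtlas hφ).comp (hψ'.contMDiffOn.mono fun p hp ↦ hp.1)
      fun p hp ↦ hp.2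

omit [IsManifold (𝓡 n) ∞ M] in
theorem components_trans (hφ : φ ∈ IsManifold.maximalAtlas (𝓡 n) ∞ M)
    (hψ : ContDiffOn ℝ ∞ ψ ψ.source) {p : M} (hp : p ∈ (φ.trans ψ).source)
    (u : TangentSpace (𝓡 n) p) :
    components (φ.trans ψ) p u = fderiv ℝ ψ (φ p) (components φ p u) := by
  have h1 := ((contMDiffAt_of_mem_maximalAtlas hφ hp.1).mdifferentiableAt (by simp)).hasMFDerivAt
  have h2 := ((hψ.contDiffAt (ψ.open_source.mem_nhds hp.2)).differentiableAt
    (by simp)).hasFDerivAt.hasMFDerivAt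
  have h3 : HasMFDerivAt (𝓡 n) (𝓡 n) (φ.trans ψ) p _ := h2.comp p h1
  rw [components, h3.mfderiv]
  rfl

theorem metricMatrix_trans (g : SmoothMetric n M) (hφ : φ ∈ IsManifold.maximalAtlas (𝓡 n) ∞ M)
    (hψ' : ContDiffOn ℝ ∞ ψ.symm ψ.target) {z : EuclideanSpace ℝ (Fin n)}
    (hz : z ∈ (φ.trans ψ).target) (i j : Fin n) :
    metricMatrix g (φ.trans ψ) z i j = metricForm g φ (ψ.symm z)
      (fderiv ℝ ψ.symm z (basisVec i)) (fderiv ℝ ψ.symm z (basisVec j)) := by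
  have h1 := (mdifferentiableAt_chart_symm hφ hz.2).hasMFDerivAt
  have h2 := ((hψ'.contDiffAt (ψ.open_target.mem_nhds hz.1)).differentiableAt
    (by simp)).hasFDerivAt.hasMFDerivAt
  have h3 : HasMFDerivAt (𝓡 n) (𝓡 n) (φ.trans ψ).symm z _ :=
    HasMFDerivAt.comp (g := φ.symm) (f := ψ.symm) z h1 h2
  rw [metricForm_apply, metricMatrix, Matrix.of_apply, coordVec, coordVec, h3.mfderiv]
  rfl

theorem fderiv_apply_fderiv_symm (hψ : ContDiffOn ℝ ∞ ψ ψ.source)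
    (hψ' : ContDiffOn ℝ ∞ ψ.symm ψ.target) {z : EuclideanSpace ℝ (Fin n)} (hz : z ∈ ψ.target)
    (u : EuclideanSpace ℝ (Fin n)) :
    fderiv ℝ ψ (ψ.symm z) (fderiv ℝ ψ.symm z u) = u := by
  have h1 := ((hψ'.contDiffAt (ψ.open_target.mem_nhds hz)).differentiableAt (by simp)).hasFDerivAt
  have h2 := ((hψ.contDiffAt (ψ.open_source.mem_nhds (ψ.map_target hz))).differentiableAt
    (by simp)).hasFDerivAt
  have h3 : (ψ ∘ ψ.symm) =ᶠ[nhds z] id := by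
    filter_upwards [ψ.open_target.mem_nhds hz] with w hw using ψ.right_inv hw
  have h4 := (h2.comp z h1).unique ((hasFDerivAt_id z).congr_of_eventuallyEq h3)
  exact congrArg (fun T ↦ T u) h4

/-- A manifold of constant curvature `-1` has horospherical coordinates around any point, with
prescribed orthonormal coordinate directions there. -/
theorem exists_isHorospherical [NeZero n] (g : SmoothMetric n M)
    (hg : HasConstantSectionalCurvature g (-1)) (p₀ : M) (v : Fin n → TangentSpace (𝓡 n) p₀)
    (hv : ∀ i j, g.inner p₀ (v i) (v j) = if i = j then 1 else 0) :
    ∃ y ∈ IsManifold.maximalAtlas (𝓡 n) ∞ M, p₀ ∈ y.source ∧ IsHorospherical g y ∧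
      ∀ i, components y p₀ (v i) = basisVec i := by
  have hφ := IsManifold.chart_mem_maximalAtlas (I := 𝓡 n) (n := ∞) p₀
  have hp := mem_chart_source (EuclideanSpace ℝ (Fin n)) p₀
  set φ := chartAt (EuclideanSpace ℝ (Fin n)) p₀
  have hinv : ∀ u : TangentSpace (𝓡 n) p₀,
      mfderiv (𝓡 n) (𝓡 n) φ.symm (φ p₀) (components φ p₀ u) = u := fun u ↦
    congrArg (fun T ↦ T u) ((mdifferentiable_chart hφ).symm_comp_deriv hp)
  obtain ⟨ψ, hxψ, hψU, hψ, hψ', hψv, hψG⟩ :=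
    (isLeviCivitaOn_chart g hφ).exists_horospherical_coordinates
      (fun x hx ↦ curvature_connectionForm g hφ hg hx) (φ.map_source hp) 0
      (w := fun i ↦ components φ p₀ (v i)) (fun i j ↦ by
        rw [metricForm_apply, hinv, hinv, ← hv i j]
        rw [φ.left_inv hp])
  refine ⟨φ.trans ψ, trans_mem_maximalAtlas hφ hψ hψ', ⟨hp, hxψ⟩, fun z hz ↦ ?_, fun i ↦ ?_⟩
  · ext i j
    have hz1 : z ∈ ψ.target := hz.1
    -- The differential of `ψ` undoes that of `ψ.symm`, so the diagonal formula for the metric is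
    -- evaluated on standard basis vectors.
    rw [metricMatrix_trans g hφ hψ' hz, hψG _ (ψ.map_target hz1), ψ.right_inv hz1]
    simp only [fderiv_apply_fderiv_symm hψ hψ' hz1, basisVec_apply]
    by_cases hij : i = j
    · simp [hij]
    · simp [hij, Ne.symm hij]
  · rw [components_trans hφ hψ ⟨hp, hxψ⟩]
    exact hψv i

end ChangeOfCoordinates

end RiemannianCoordinates

end

/-! ### Conclusion from horospherical coordinates -/

open RiemannianCoordinates in
theorem corollary1 {n : ℕ} [NeZero n] {M : Type*} [TopologicalSpace M]
    [ChartedSpace (EuclideanSpace ℝ (Fin n)) M] [IsManifold (𝓡 n) ∞ M]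
    (g : SmoothMetric n M) (hg : HasConstantSectionalCurvature g (-1))
    (p₀ : M) (v : Fin n → TangentSpace (𝓡 n) p₀)
    (hv : ∀ i j, g.inner p₀ (v i) (v j) = if i = j then 1 else 0) :
    ∃ y ∈ IsManifold.maximalAtlas (𝓡 n) ∞ M, p₀ ∈ y.source ∧
      -- the coordinates are orthogonal
      (∀ x ∈ y.target, ∀ i j, i ≠ j →
        g.inner (y.symm x) (coordVec y x i) (coordVec y x j) = 0) ∧
      -- the curves of the first coordinate are geodesics
      (∀ x ∈ y.target, IsGeodesicOn g (coordCurve y x 0) (coordCurveDomain y x 0)) ∧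
      -- the curves of the other coordinates are horocycles
      (∀ x ∈ y.target, ∀ i, i ≠ 0 →
        IsHorocycleOn g (coordCurve y x i) (coordCurveDomain y x i)) ∧
      -- at the given point the coordinate curves have the given directions
      (∀ i, ∃ c : ℝ, 0 < c ∧ components y p₀ (v i) = c • basisVec i) := by
  obtain ⟨y, hy, hp, h, hyv⟩ := exists_isHorospherical g hg p₀ v hv
  refine ⟨y, hy, hp, fun x hx i j hij ↦ ?_, fun x _ ↦ isGeodesicOn_coordCurve hy h x,
    fun x _ i hi ↦ isHorocycleOn_coordCurve hy h x hi, fun i ↦ ⟨1, one_pos, ?_⟩⟩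
  · have := congrFun (congrFun (h x hx) i) j
    rw [Matrix.diagonal_apply_ne _ hij] at this
    exact this
  · rw [hyv, one_smul]
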